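/- Let $k$ be a field, let $Q$ be a finite quiver and let $A = kQ/I$ be a gentle algebra. Paths are composed from right to left, and modules are left modules. Gentle means: $I$ is generated by paths of length two; all sufficiently long paths lie in $I$ (equivalently, $A$ is finite-dimensional); at most two arrows start and at most two arrows end at each vertex; and for every arrow $b$ there is at most one arrow $a$ such that $ba$ is a path not in $I$, at most one arrow $a$ such that $ba$ is a path in $I$, at most one arrow $c$ such that $cb$ is a path not in $I$, and at most one arrow $c$ such that $cb$ is a path in $I$. A path in $(Q,I)$ is a path of $Q$ (possibly trivial) that is not in $I$. A finite string $w = a_n\cdots a_1$ (respectively an $\mathbb{N}$-string $w=\cdots a_3a_2a_1$) is a sequence of letters $a_j\colon i_{j-1}\to i_j$, each an arrow (direct letter) or a formal inverse of an arrow (inverse letter), such that $a_{j+1}\neq a_j^{-1}$ and neither $a_{j+1}a_j$ nor its inverse is a path in $I$; for $n=0$ it is the trivial string at a vertex $i_0$. The string module $M(w)$ of a finite string has a $k$-basis $(v_j)_{0\le j\le n}$ with $v_j$ at the vertex $i_j$; an arrow $a$ sends $v_{j-1}$ to $v_j$ if $a_j=a$, sends $v_j$ to $v_{j-1}$ if $a_j=a^{-1}$,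 and all its other components are zero. For an $\mathbb{N}$-string the same rule defines a module $M^{\oplus}(w)$ on the direct sum $\bigoplus_{j\geq 0}kv_j$ and a module $M^{\Pi}(w)$ on the direct product $\prod_{j\geq 0}kv_j$. If $w$ is eventually periodic, let $\cdots a_{p+2}a_{p+1}$ be its maximal periodic part and $n$ a period of it; $w$ is expanding if $a_{p+n}$ is direct and contracting if $a_{p+n}$ is inverse. Put $M(w)=M^{\Pi}(w)$ if $w$ is expanding, and $M(w)=M^{\oplus}(w)$ if it is contracting (or is not eventually periodic). Write a finite string uniquely as $w=q_n^{-1}p_n\cdots q_1^{-1}p_1q_0^{-1}p_0$, and an $\mathbb{N}$-string as $w=\cdots q_1^{-1}p_1q_0^{-1}p_0$, where the $p_i,q_i$ are paths in $(Q,I)$, of positive length except possibly $p_0$ and (in the finite case) $q_n$. Then the injective dimension of $M(w)$ over $A$ is at most $1$ if and only if the following conditions are satisfied. (1) If there is an arrow $l_0$ such that $p_0l_0$ is a path in $(Q,I)$ and $w$ does not begin with the letter $l_0^{-1}$ (that is, such that $wl_0$ is a string), then there is no arrow $a$ such that $l_0a$ is a path in $I$. (2) If $w$ is a finite string and there is an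 arrow $l_n$ such that $q_nl_n$ is a path in $(Q,I)$ and $w$ does not end with the letter $l_n$ (that is, such that $w^{-1}l_n$ is a string), then there is no arrow $a$ such that $l_na$ is a path in $I$. For an $\mathbb{N}$-string $w$, condition (1) is moreover equivalent to $M^{\Pi}(w)$ having injective dimension at most $1$, and also to $M^{\oplus}(w)$ having injective dimension at most $1$. -/

import Mathlib

universe u

noncomputable section

/-! ### The path algebra of a finite quiver

`Quiver.Path i j` is the type of paths from `i` to `j`, and `Quiver.Total V` is the type of all
arrows of the quiver; the arrow `a` has source `a.left` and target `a.right`.  Paths are multiplied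
from right to left: `q * p` is "first `p`, then `q`". -/

/-- All paths of the quiver `V`, as triples (source, target, path). -/
abbrev TotalPath (V : Type u) [Quiver.{u} V] : Type u := Σ i j : V, Quiver.Path i j

/-- The path algebra `kQ`: the vector space with basis the paths of `Q`. -/
def PathAlgebra (k V : Type u) [Field k] [Quiver.{u} V] : Type u := TotalPath V →₀ k

namespace PathAlgebra

variable {k V : Type u} [Field k] [Quiver.{u} V]

instance : AddCommGroup (PathAlgebra k V) := inferInstanceAs (AddCommGroup (TotalPath V →₀ k))
instance : Module k (PathAlgebra k V) := inferInstanceAs (Module k (TotalPath V →₀ k))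

variable (k) in
/-- The basis element of `kQ` given by a path. -/
def ofPath {i j : V} (p : Quiver.Path i j) : PathAlgebra k V :=
  Finsupp.single (⟨i, j, p⟩ : TotalPath V) (1 : k)

variable (k) in
/-- The trivial path `e_i` as an element of `kQ`. -/
def idem (i : V) : PathAlgebra k V := ofPath k (Quiver.Path.nil : Quiver.Path i i)

variable (k) in
/-- An arrow as an element of `kQ`. -/
def arrow (a : Quiver.Total V) : PathAlgebra k V := ofPath k a.hom.toPath

/-- The linear extension of a function defined on paths. -/
def extend {M : Type*} [AddCommGroup M] [Module k M]
    (φ : ∀ i j : V, Quiver.Path i j → M) : PathAlgebra k V →ₗ[k] M :=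
  Finsupp.linearCombination k (fun p : TotalPath V => φ p.1 p.2.1 p.2.2)

theorem extend_ofPath {M : Type*} [AddCommGroup M] [Module k M]
    (φ : ∀ i j : V, Quiver.Path i j → M) {i j : V} (p : Quiver.Path i j) :
    extend φ (ofPath k p) = φ i j p := by
  exact (Finsupp.linearCombination_single k (1 : k) (⟨i, j, p⟩ : TotalPath V)).trans (one_smul k _)

theorem induction {P : PathAlgebra k V → Prop} (x : PathAlgebra k V) (zero : P 0)
    (add : ∀ x y, P x → P y → P (x + y)) (smul : ∀ (c : k) x, P x → P (c • x))
    (path : ∀ (i j : V) (p : Quiver.Path i j), P (ofPath k p)) : P x := by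
  refine Finsupp.induction_linear (motive := P) x zero (fun f g => add f g) ?_
  rintro ⟨i, j, p⟩ c
  have h : (Finsupp.single (⟨i, j, p⟩ : TotalPath V) c : TotalPath V →₀ k)
      = c • Finsupp.single (⟨i, j, p⟩ : TotalPath V) (1 : k) := by simp
  rw [h]
  exact smul c _ (path i j p)

open Classical in
variable (k) in
/-- The product `q p` of two paths: the concatenation "first `p`, then `q`" if `p` ends where
`q` starts, and zero otherwise. -/
def mulPath {i j i' j' : V} (q : Quiver.Path i' j') (p : Quiver.Path i j) : PathAlgebra k V :=
  if h : j = i' then ofPath k ((p.cast rfl h).comp q) else 0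

/-- The multiplication of `kQ`, as a bilinear map. -/
def mulHom : PathAlgebra k V →ₗ[k] PathAlgebra k V →ₗ[k] PathAlgebra k V :=
  extend fun _ _ q => extend fun _ _ p => mulPath k q p

instance : Mul (PathAlgebra k V) := ⟨fun x y => mulHom x y⟩

theorem mul_def (x y : PathAlgebra k V) : x * y = mulHom x y := rfl

theorem ofPath_mul_ofPath {i j i' j' : V} (q : Quiver.Path i' j') (p : Quiver.Path i j) :
    ofPath k q * ofPath k p = mulPath k q p := by
  rw [mul_def, mulHom, extend_ofPath, extend_ofPath]

theorem ofPath_mul_ofPath_comp {i j l : V} (q : Quiver.Path j l) (p : Quiver.Path i j) :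
    ofPath k q * ofPath k p = ofPath k (p.comp q) := by
  rw [ofPath_mul_ofPath, mulPath, dif_pos rfl]; rfl

theorem ofPath_mul_ofPath_ne {i j i' j' : V} (q : Quiver.Path i' j') (p : Quiver.Path i j)
    (h : j ≠ i') : ofPath k q * ofPath k p = 0 := by
  rw [ofPath_mul_ofPath, mulPath, dif_neg h]

theorem mul_assoc' (x y z : PathAlgebra k V) : x * y * z = x * (y * z) := by
  simp only [mul_def]
  induction x using induction with
  | zero => simp
  | add x x' h h' => simp [h, h']
  | smul c x h => simp [h]
  | path i j p =>
    induction y using induction with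
    | zero => simp
    | add y y' h h' => simp [h, h']
    | smul c y h => simp [h]
    | path i' j' q =>
      induction z using induction with
      | zero => simp
      | add z z' h h' => simp [h, h']
      | smul c z h => simp [h]
      | path i'' j'' r =>
        simp only [← mul_def]
        by_cases h : j' = i
        · subst h
          rw [ofPath_mul_ofPath_comp]
          by_cases h' : j'' = i'
          · subst h'
            rw [ofPath_mul_ofPath_comp, ofPath_mul_ofPath_comp, ofPath_mul_ofPath_comp,
              Quiver.Path.comp_assoc]
          · rw [ofPath_mul_ofPath_ne _ _ h', ofPath_mul_ofPath_ne _ _ h']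
            simp [mul_def]
        · rw [ofPath_mul_ofPath_ne _ _ h]
          by_cases h' : j'' = i'
          · subst h'
            rw [ofPath_mul_ofPath_comp, ofPath_mul_ofPath_ne _ _ h]
            simp [mul_def]
          · rw [ofPath_mul_ofPath_ne _ _ h']
            simp [mul_def]

variable [Fintype V]

instance : One (PathAlgebra k V) := ⟨∑ i : V, idem k i⟩

theorem one_def : (1 : PathAlgebra k V) = ∑ i : V, idem k i := rfl

theorem one_mul' (x : PathAlgebra k V) : 1 * x = x := by
  classical
  rw [mul_def]
  induction x using induction with
  | zero => simp
  | add x x' h h' => simp [h, h']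
  | smul c x h => simp [h]
  | path i j p =>
    rw [one_def, map_sum, LinearMap.sum_apply, Finset.sum_eq_single j]
    · rw [← mul_def, idem, ofPath_mul_ofPath_comp, Quiver.Path.comp_nil]
    · intro l _ hl
      rw [← mul_def, idem, ofPath_mul_ofPath_ne _ _ (Ne.symm hl)]
    · simp

theorem mul_one' (x : PathAlgebra k V) : x * 1 = x := by
  classical
  rw [mul_def]
  induction x using induction with
  | zero => simp
  | add x x' h h' => simp [h, h']
  | smul c x h => simp [h]
  | path i j p =>
    rw [one_def, map_sum, Finset.sum_eq_single i]
    · rw [← mul_def, idem, ofPath_mul_ofPath_comp, Quiver.Path.nil_comp]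
    · intro l _ hl
      rw [← mul_def, idem, ofPath_mul_ofPath_ne _ _ hl]
    · simp

instance : Ring (PathAlgebra k V) :=
  { (inferInstance : AddCommGroup (PathAlgebra k V)) with
    mul := (· * ·)
    one := 1
    mul_assoc := mul_assoc'
    one_mul := one_mul'
    mul_one := mul_one'
    left_distrib := fun x y z => by simp [mul_def]
    right_distrib := fun x y z => by simp [mul_def]
    zero_mul := fun x => by simp [mul_def]
    mul_zero := fun x => by simp [mul_def] }

instance : Algebra k (PathAlgebra k V) :=
  Algebra.ofModule (fun c x y => by simp [mul_def]) (fun c x y => by simp [mul_def])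

/-- The value of a path, when the trivial paths and the arrows are given values. -/
def pathValue {B : Type*} [Ring B] (e : V → B) (f : Quiver.Total V → B) {i : V} :
    ∀ {j : V}, Quiver.Path i j → B
  | _, Quiver.Path.nil => e i
  | _, Quiver.Path.cons p a => f ⟨_, _, a⟩ * pathValue e f p

/-- An algebra homomorphism out of `kQ` is given by the images `e i` of the trivial paths (a complete
set of orthogonal idempotents) and the images `f a` of the arrows. -/
def lift {B : Type*} [Ring B] [Algebra k B] (e : V → B) (f : Quiver.Total V → B)
    (e_mul_self : ∀ i, e i * e i = e i) (e_mul_ne : ∀ i j, i ≠ j → e i * e j = 0)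
    (e_sum : ∑ i, e i = 1) (e_mul_f : ∀ a, e a.right * f a = f a)
    (_f_mul_e : ∀ a, f a * e a.left = f a) : PathAlgebra k V →ₐ[k] B :=
  have left_e : ∀ {i j : V} (p : Quiver.Path i j), e j * pathValue e f p = pathValue e f p := by
    intro i j p
    cases p with
    | nil => exact e_mul_self i
    | cons p a => rw [pathValue, ← mul_assoc, e_mul_f ⟨_, _, a⟩]
  have right_e : ∀ {i j : V} (p : Quiver.Path i j), pathValue e f p * e i = pathValue e f p := by
    intro i j p
    induction p with
    | nil => exact e_mul_self i
    | cons p a ih => rw [pathValue, mul_assoc, ih]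
  have comp : ∀ {i j l : V} (q : Quiver.Path j l) (p : Quiver.Path i j),
      pathValue e f (p.comp q) = pathValue e f q * pathValue e f p := by
    intro i j l q p
    induction q with
    | nil => rw [Quiver.Path.comp_nil, pathValue, left_e]
    | cons q a ih => rw [Quiver.Path.comp_cons, pathValue, pathValue, ih, mul_assoc]
  AlgHom.ofLinearMap (extend fun _ _ p => pathValue e f p)
    (by
      rw [one_def, map_sum, ← e_sum]
      exact Finset.sum_congr rfl fun i _ => by rw [idem, extend_ofPath, pathValue])
    (by
      intro x y
      induction x using induction with
      | zero => simp
      | add x x' h h' => simp [add_mul, h, h']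
      | smul c x h => simp [h]
      | path i j q =>
        induction y using induction with
        | zero => simp
        | add y y' h h' => simp [mul_add, h, h']
        | smul c y h => simp [h]
        | path i' j' p =>
          rw [extend_ofPath, extend_ofPath]
          by_cases h : j' = i
          · subst h
            rw [ofPath_mul_ofPath_comp, extend_ofPath, comp]
          · rw [ofPath_mul_ofPath_ne _ _ h, map_zero, ← left_e p, ← right_e q, mul_assoc,
              ← mul_assoc (e i), e_mul_ne i j' (Ne.symm h), zero_mul, mul_zero])

theorem lift_ofPath {B : Type*} [Ring B] [Algebra k B] (e : V → B) (f : Quiver.Total V → B)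
    (h₁ h₂ h₃ h₄ h₅) {i j : V} (p : Quiver.Path i j) :
    lift (k := k) e f h₁ h₂ h₃ h₄ h₅ (ofPath k p) = pathValue e f p :=
  extend_ofPath _ p

theorem lift_arrow {B : Type*} [Ring B] [Algebra k B] (e : V → B) (f : Quiver.Total V → B)
    (h₁ h₂ h₃ h₄ h₅) (a : Quiver.Total V) :
    lift (k := k) e f h₁ h₂ h₃ h₄ h₅ (arrow k a) = f a := by
  rw [arrow, lift_ofPath]
  exact h₅ a

end PathAlgebra

open PathAlgebra

/-! ### Gentle algebras -/

section Gentle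

variable {k V : Type u} [Field k] [Quiver.{u} V] [Fintype V]

/-- The algebra `kQ/I`. -/
abbrev BoundAlgebra (I : TwoSidedIdeal (PathAlgebra k V)) : Type u := I.ringCon.Quotient

/-- The pair `(Q, I)` is gentle, that is, `kQ/I` is a gentle algebra. -/
structure IsGentle (I : TwoSidedIdeal (PathAlgebra k V)) : Prop where
  /-- At most two arrows start at each vertex. -/
  outgoing : ∀ i : V, {a : Quiver.Total V | a.left = i}.encard ≤ 2
  /-- At most two arrows end at each vertex. -/
  incoming : ∀ i : V, {a : Quiver.Total V | a.right = i}.encard ≤ 2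
  /-- For each arrow `b` there is at most one arrow `c` such that `cb` is a path not in `I`. -/
  unique_left_nonzero : ∀ b c c' : Quiver.Total V, c.left = b.right → c'.left = b.right →
    arrow k c * arrow k b ∉ I → arrow k c' * arrow k b ∉ I → c = c'
  /-- For each arrow `b` there is at most one arrow `a` such that `ba` is a path not in `I`. -/
  unique_right_nonzero : ∀ b a a' : Quiver.Total V, a.right = b.left → a'.right = b.left →
    arrow k b * arrow k a ∉ I → arrow k b * arrow k a' ∉ I → a = a'
  /-- For each arrow `b` there is at most one arrow `c` such that `cb` is a path in `I`. -/
  unique_left_zero : ∀ b c c' : Quiver.Total V, c.left = b.right → c'.left = b.right →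
    arrow k c * arrow k b ∈ I → arrow k c' * arrow k b ∈ I → c = c'
  /-- For each arrow `b` there is at most one arrow `a` such that `ba` is a path in `I`. -/
  unique_right_zero : ∀ b a a' : Quiver.Total V, a.right = b.left → a'.right = b.left →
    arrow k b * arrow k a ∈ I → arrow k b * arrow k a' ∈ I → a = a'
  /-- The ideal `I` is generated by a set of paths `ba` of length two. -/
  generated : ∃ R : Set (Quiver.Total V × Quiver.Total V), (∀ r ∈ R, r.2.right = r.1.left) ∧
    I = TwoSidedIdeal.span ((fun r => arrow k r.1 * arrow k r.2) '' R)
  /-- All sufficiently long paths are in `I`; equivalently, `kQ/I` is finite-dimensional. -/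
  nilpotent : ∃ N : ℕ, ∀ (i j : V) (p : Quiver.Path i j), N ≤ p.length → ofPath k p ∈ I

/-! ### Strings -/

/-- The nontrivial letters: arrows and their formal inverses. -/
inductive Letter (V : Type u) [Quiver.{u} V] : Type u
  | direct (a : Quiver.Total V)
  | inverse (a : Quiver.Total V)

namespace Letter

variable {W : Type u} [Quiver.{u} W]

/-- The source of a letter. -/
def source : Letter W → W
  | direct a => a.left
  | inverse a => a.right

/-- The target of a letter. -/
def target : Letter W → W
  | direct a => a.right
  | inverse a => a.left

/-- The formal inverse of a letter. -/
def inv : Letter W → Letter W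
  | direct a => inverse a
  | inverse a => direct a

end Letter

/-- The word `y x` of two letters (first `x`, then `y`) may occur in a string: it is not
of the form `x⁻¹ x`, and neither it nor its inverse is a path in `I`. -/
def Letter.Compatible (I : TwoSidedIdeal (PathAlgebra k V)) (x y : Letter V) : Prop :=
  y ≠ x.inv ∧
  (∀ a b, x = .direct a → y = .direct b → arrow k b * arrow k a ∉ I) ∧
  (∀ a b, x = .inverse b → y = .inverse a → arrow k b * arrow k a ∉ I)

/-- A finite string `w = a_n … a_2 a_1` of length `n`, with `a_j : i_{j-1} → i_j`.  Here
`vertex j` is `i_j` and `letter j` is `a_{j+1}`.  For `n = 0` this is a trivial string. -/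
structure FiniteString (I : TwoSidedIdeal (PathAlgebra k V)) (n : ℕ) where
  vertex : Fin (n + 1) → V
  letter : Fin n → Letter V
  source_letter : ∀ j, (letter j).source = vertex j.castSucc
  target_letter : ∀ j, (letter j).target = vertex j.succ
  compatible : ∀ j j' : Fin n, (j : ℕ) + 1 = j' → (letter j).Compatible I (letter j')

/-- An ℕ-string `w = … a_3 a_2 a_1`, with `a_j : i_{j-1} → i_j`.  Here `vertex j` is `i_j`
and `letter j` is `a_{j+1}`. -/
structure NString (I : TwoSidedIdeal (PathAlgebra k V)) where
  vertex : ℕ → V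
  letter : ℕ → Letter V
  source_letter : ∀ j, (letter j).source = vertex j
  target_letter : ∀ j, (letter j).target = vertex (j + 1)
  compatible : ∀ j, (letter j).Compatible I (letter (j + 1))

/-! ### String modules -/

/-- The shape of a string module: a set `P` of positions (indexing the standard basis), the vertex
at each position, and the relation `step a x y`: "the arrow `a` sends the basis vector at `x` to the
basis vector at `y`". -/
structure StringDiagram (I : TwoSidedIdeal (PathAlgebra k V)) where
  P : Type
  vertex : P → V
  step : Quiver.Total V → P → P → Prop
  step_source : ∀ a x y, step a x y → vertex x = a.left
  step_target : ∀ a x y, step a x y → vertex y = a.right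
  step_step : ∀ a b x y z, step a x y → step b y z → arrow k b * arrow k a ∉ I
  finite_preds : ∀ a y, {x | step a x y}.Finite
  finite_succs : ∀ a x, {y | step a x y}.Finite

namespace StringDiagram

variable {I : TwoSidedIdeal (PathAlgebra k V)} (D : StringDiagram I)

open Classical in
/-- The action of `e_i` on families of scalars indexed by the positions: the projection onto the
positions at the vertex `i`. -/
def idemOp (i : V) : Module.End k (D.P → k) where
  toFun f := fun x => if D.vertex x = i then f x else 0
  map_add' f g := by ext x; by_cases h : D.vertex x = i <;> simp [h]
  map_smul' c f := by ext x; by_cases h : D.vertex x = i <;> simp [h]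

/-- The action of the arrow `a`: its component from position `x` to position `y` is `1` if
`step a x y` and `0` otherwise. -/
def arrowOp (a : Quiver.Total V) : Module.End k (D.P → k) where
  toFun f := fun y => ∑ x ∈ (D.finite_preds a y).toFinset, f x
  map_add' f g := by ext y; simp [Finset.sum_add_distrib]
  map_smul' c f := by ext y; simp [Finset.mul_sum]

/-- The representation of the path algebra. -/
def pathRep : PathAlgebra k V →ₐ[k] Module.End k (D.P → k) :=
  PathAlgebra.lift D.idemOp D.arrowOp
    (fun i => by
      ext1 f; funext x
      by_cases h : D.vertex x = i <;> simp [idemOp, h])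
    (fun i j hij => by
      ext1 f; funext x
      by_cases h : D.vertex x = i
      · subst h; simp [idemOp, hij]
      · simp [idemOp, h])
    (by
      classical
      ext1 f; funext x
      simp only [idemOp, LinearMap.sum_apply, Finset.sum_apply, LinearMap.coe_mk, AddHom.coe_mk,
        Module.End.one_apply]
      exact (Finset.sum_eq_single (D.vertex x) (fun i _ hi => if_neg (Ne.symm hi))
        (fun h => absurd (Finset.mem_univ _) h)).trans (if_pos rfl))
    (fun a => by
      ext1 f; funext y
      by_cases h : D.vertex y = a.right
      · simp [idemOp, arrowOp, h]
      · have : (D.finite_preds a y).toFinset = ∅ := by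
          ext x
          simpa using fun hx => h (D.step_target a x y hx)
        simp [idemOp, arrowOp, h, this])
    (fun a => by
      ext1 f; funext y
      simp only [arrowOp, idemOp, Module.End.mul_apply, LinearMap.coe_mk, AddHom.coe_mk]
      refine Finset.sum_congr rfl fun x hx => ?_
      rw [if_pos (D.step_source a x y (by simpa using hx))])

theorem pathRep_eq_zero (hI : IsGentle I) (r : PathAlgebra k V) (hr : r ∈ I) :
    D.pathRep r = 0 := by
  obtain ⟨R, -, hR⟩ := hI.generated
  have hker : I ≤ TwoSidedIdeal.ker D.pathRep := by
    conv_lhs => rw [hR]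
    rw [TwoSidedIdeal.span_le]
    rintro _ ⟨⟨b, a⟩, hba, rfl⟩
    have hmem : arrow k b * arrow k a ∈ I := by
      rw [hR]
      exact TwoSidedIdeal.subset_span ⟨⟨b, a⟩, hba, rfl⟩
    rw [SetLike.mem_coe, TwoSidedIdeal.mem_ker, map_mul]
    simp only [pathRep, lift_arrow]
    ext1 f; funext z
    simp only [arrowOp, Module.End.mul_apply, LinearMap.coe_mk, AddHom.coe_mk]
    refine Finset.sum_eq_zero fun y hy => Finset.sum_eq_zero fun x hx => ?_
    exact absurd hmem (D.step_step a b x y z (by simpa using hx) (by simpa using hy))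
  exact (TwoSidedIdeal.mem_ker _).mp (hker hr)

/-- The representation of `kQ/I`. -/
def rep (hI : IsGentle I) : BoundAlgebra I →+* Module.End k (D.P → k) :=
  I.ringCon.lift (D.pathRep : PathAlgebra k V →+* Module.End k (D.P → k)) (by
    intro x y hxy
    rw [TwoSidedIdeal.rel_iff] at hxy
    have := D.pathRep_eq_zero hI _ hxy
    rw [map_sub, sub_eq_zero] at this
    exact this)

theorem finite_support_pathRep (r : PathAlgebra k V) (f : D.P → k) (hf : f.support.Finite) :
    (D.pathRep r f).support.Finite := by
  classical
  induction r using PathAlgebra.induction with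
  | zero => simp
  | add x y hx hy =>
    rw [map_add]
    exact (hx.union hy).subset (Function.support_add _ _)
  | smul c x hx =>
    rw [map_smul]
    exact hx.subset (Function.support_const_smul_subset c _)
  | path i j p =>
    rw [pathRep, lift_ofPath]
    induction p with
    | nil =>
      refine hf.subset fun x hx => ?_
      simp only [pathValue, idemOp, LinearMap.coe_mk, AddHom.coe_mk, Function.mem_support] at hx ⊢
      exact fun h => hx (by simp [h])
    | cons p a ih =>
      refine (ih.biUnion fun x _ => D.finite_succs ⟨_, _, a⟩ x).subset fun y hy => ?_
      simp only [pathValue, arrowOp, Module.End.mul_apply, LinearMap.coe_mk, AddHom.coe_mk,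
        Function.mem_support] at hy
      obtain ⟨x, hx, hx'⟩ := Finset.exists_ne_zero_of_sum_ne_zero hy
      simp only [Set.mem_iUnion]
      exact ⟨x, hx', by simpa using hx⟩

/-- The `kQ/I`-module of all families of scalars indexed by the positions. -/
def prodModule (hI : IsGentle I) : ModuleCat.{u} (BoundAlgebra I) :=
  letI : Module (BoundAlgebra I) (D.P → k) := Module.compHom (D.P → k) (D.rep hI)
  ModuleCat.of (BoundAlgebra I) (D.P → k)

/-- The `kQ/I`-module of the finitely supported families of scalars indexed by the positions. -/
def sumModule (hI : IsGentle I) : ModuleCat.{u} (BoundAlgebra I) :=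
  letI : Module (BoundAlgebra I) (D.P → k) := Module.compHom (D.P → k) (D.rep hI)
  ModuleCat.of (BoundAlgebra I)
    ({ carrier := {f : D.P → k | f.support.Finite}
       add_mem' := fun hf hg => (hf.union hg).subset (Function.support_add _ _)
       zero_mem' := by simp
       smul_mem' := fun r f hf => by
        obtain ⟨r, rfl⟩ := Quotient.exists_rep r
        exact D.finite_support_pathRep r f hf } : Submodule (BoundAlgebra I) (D.P → k))

end StringDiagram

/-- The diagram of a finite string: a direct letter `a_{j+1} = a` sends the basis vector `v_j` to
`v_{j+1}` under `a`, an inverse letter `a_{j+1} = a⁻¹` sends `v_{j+1}` to `v_j` under `a`. -/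
def FiniteString.diagram {I : TwoSidedIdeal (PathAlgebra k V)} {n : ℕ} (w : FiniteString I n) :
    StringDiagram I where
  P := Fin (n + 1)
  vertex := w.vertex
  step a x y := ∃ j : Fin n, (x = j.castSucc ∧ y = j.succ ∧ w.letter j = .direct a) ∨
    (x = j.succ ∧ y = j.castSucc ∧ w.letter j = .inverse a)
  step_source := by
    rintro a x y ⟨j, ⟨rfl, rfl, h⟩ | ⟨rfl, rfl, h⟩⟩
    · rw [← w.source_letter, h]; rfl
    · rw [← w.target_letter, h]; rfl
  step_target := by
    rintro a x y ⟨j, ⟨rfl, rfl, h⟩ | ⟨rfl, rfl, h⟩⟩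
    · rw [← w.target_letter, h]; rfl
    · rw [← w.source_letter, h]; rfl
  step_step := by
    rintro a b x y z ⟨j, ⟨rfl, rfl, h⟩ | ⟨rfl, rfl, h⟩⟩ ⟨j', ⟨h₁, rfl, h'⟩ | ⟨h₁, rfl, h'⟩⟩
    · exact (w.compatible j j' (by simpa [Fin.ext_iff] using h₁)).2.1 a b h h'
    · obtain rfl := Fin.succ_injective _ h₁
      rw [h] at h'; cases h'
    · obtain rfl := Fin.castSucc_injective _ h₁
      rw [h] at h'; cases h'
    · exact (w.compatible j' j (by simpa [Fin.ext_iff] using h₁.symm)).2.2 a b h' h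
  finite_preds _ _ := Set.toFinite _
  finite_succs _ _ := Set.toFinite _

/-- The diagram of an ℕ-string, defined by the same rule as for finite strings. -/
def NString.diagram {I : TwoSidedIdeal (PathAlgebra k V)} (w : NString I) :
    StringDiagram I where
  P := ℕ
  vertex := w.vertex
  step a x y := ∃ j : ℕ, (x = j ∧ y = j + 1 ∧ w.letter j = .direct a) ∨
    (x = j + 1 ∧ y = j ∧ w.letter j = .inverse a)
  step_source := by
    rintro a x y ⟨j, ⟨rfl, rfl, h⟩ | ⟨rfl, rfl, h⟩⟩
    · rw [← w.source_letter, h]; rfl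
    · rw [← w.target_letter, h]; rfl
  step_target := by
    rintro a x y ⟨j, ⟨rfl, rfl, h⟩ | ⟨rfl, rfl, h⟩⟩
    · rw [← w.target_letter, h]; rfl
    · rw [← w.source_letter, h]; rfl
  step_step := by
    rintro a b x y z ⟨j, ⟨rfl, rfl, h⟩ | ⟨rfl, rfl, h⟩⟩ ⟨j', ⟨h₁, rfl, h'⟩ | ⟨h₁, rfl, h'⟩⟩
    · subst h₁
      exact (w.compatible x).2.1 a b h h'
    · obtain rfl := Nat.succ_injective h₁
      rw [h] at h'; cases h'
    · subst h₁
      rw [h] at h'; cases h'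
    · subst h₁
      exact (w.compatible z).2.2 a b h' h
  finite_preds _ y := (Set.finite_le_nat (y + 1)).subset (by
    rintro x ⟨j, ⟨rfl, rfl, -⟩ | ⟨rfl, rfl, -⟩⟩ <;> simp only [Set.mem_ofPred_eq] <;> omega)
  finite_succs _ x := (Set.finite_le_nat (x + 1)).subset (by
    rintro y ⟨j, ⟨rfl, rfl, -⟩ | ⟨rfl, rfl, -⟩⟩ <;> simp only [Set.mem_ofPred_eq] <;> omega)

/-- The string module `M(w)` of a finite string. -/
def FiniteString.stringModule {I : TwoSidedIdeal (PathAlgebra k V)} (hI : IsGentle I) {n : ℕ}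
    (w : FiniteString I n) : ModuleCat.{u} (BoundAlgebra I) :=
  w.diagram.prodModule hI

namespace NString

variable {I : TwoSidedIdeal (PathAlgebra k V)}

/-- The module `M^Π(w)` of an ℕ-string. -/
def prodStringModule (hI : IsGentle I) (w : NString I) : ModuleCat.{u} (BoundAlgebra I) :=
  w.diagram.prodModule hI

/-- The module `M^⊕(w)` of an ℕ-string. -/
def sumStringModule (hI : IsGentle I) (w : NString I) : ModuleCat.{u} (BoundAlgebra I) :=
  w.diagram.sumModule hI

/-- The tail `… a_{p+2} a_{p+1}` is periodic with period `n`. -/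
def PeriodicFrom (w : NString I) (p n : ℕ) : Prop :=
  0 < n ∧ ∀ j, p ≤ j → w.letter (j + n) = w.letter j

/-- The ℕ-string is eventually periodic, and its maximal periodic part is `… a_{p+2} a_{p+1}`, with
period `n`. -/
def MaximalPeriodicPart (w : NString I) (p n : ℕ) : Prop :=
  w.PeriodicFrom p n ∧ ∀ p' n', w.PeriodicFrom p' n' → p ≤ p'

/-- The ℕ-string is expanding: its maximal periodic part is `… a_{p+2} a_{p+1}`, with period `n`,
and `a_{p+n}` is a direct letter.  (It is contracting if `a_{p+n}` is an inverse letter.) -/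
def IsExpanding (w : NString I) : Prop :=
  ∃ p n, w.MaximalPeriodicPart p n ∧ ∃ a, w.letter (p + n - 1) = .direct a

open Classical in
/-- The string module `M(w)` of an ℕ-string: `M^Π(w)` if `w` is expanding, and `M^⊕(w)` otherwise,
in particular if `w` is contracting. -/
def stringModule (hI : IsGentle I) (w : NString I) : ModuleCat.{u} (BoundAlgebra I) :=
  if w.IsExpanding then w.prodStringModule hI else w.sumStringModule hI

end NString

/-! ### The condition at an end of a string

A string is read from one of its ends, as a start vertex `i` and a sequence
`x : ℕ → Option (Letter V)` of letters, which is `none` after the last letter. -/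

/-- The sequence of letters of a finite string, read from the start. -/
def FiniteString.fromStart {I : TwoSidedIdeal (PathAlgebra k V)} {n : ℕ} (w : FiniteString I n)
    (j : ℕ) : Option (Letter V) :=
  if h : j < n then some (w.letter ⟨j, h⟩) else none

/-- The sequence of letters of the inverse `w⁻¹` of a finite string, read from its start, which is the
end of `w`. -/
def FiniteString.fromEnd {I : TwoSidedIdeal (PathAlgebra k V)} {n : ℕ} (w : FiniteString I n)
    (j : ℕ) : Option (Letter V) :=
  if h : j < n then some (w.letter (Fin.rev ⟨j, h⟩)).inv else none

/-- The sequence of letters of an ℕ-string. -/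
def NString.fromStart {I : TwoSidedIdeal (PathAlgebra k V)} (w : NString I)
    (j : ℕ) : Option (Letter V) :=
  some (w.letter j)

/-- The list of arrows `p` is the longest initial sequence of direct letters of `x`. -/
def IsInitialPath (x : ℕ → Option (Letter V)) (p : List (Quiver.Total V)) : Prop :=
  (∀ (j : ℕ) (h : j < p.length), x j = some (.direct p[j])) ∧
    ∀ a, x p.length ≠ some (.direct a)

variable (k) in
/-- The product `a_m … a_2 a_1 e_i` in `kQ`, where `p` is the list `[a_1, a_2, …, a_m]`. -/
def pathProduct (i : V) (p : List (Quiver.Total V)) : PathAlgebra k V :=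
  p.foldl (fun r a => arrow k a * r) (idem k i)

/-- The condition at an end of a string with initial path `p`:
if `l` is an arrow such that `p l` is a path in `(Q, I)` and the string does not begin with the letter
`l⁻¹`, then there is no arrow `a` such that `l a` is a path in `I`.  (The product `p l` in `kQ` is
zero, hence in `I`, if `l` does not end where `p` starts.) -/
def EndCondition (I : TwoSidedIdeal (PathAlgebra k V)) (i : V) (x : ℕ → Option (Letter V)) : Prop :=
  ∀ p : List (Quiver.Total V), IsInitialPath x p →
    ∀ l : Quiver.Total V, pathProduct k i p * arrow k l ∉ I → x 0 ≠ some (.inverse l) →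
      ¬ ∃ a : Quiver.Total V, a.right = l.left ∧ arrow k l * arrow k a ∈ I

end Gentle

end

/-! Injectivity over `A = kQ/I` can be tested by adjoining one vector at a time. Since long paths
lie in `I`, a proper submodule `L ⊂ N` always misses some vector `x`, at a single vertex `i`, all of
whose images under arrows lie in `L`. A map `L → E` extends to `x` as soon as `E` has a vector `ε`
at `i` with prescribed images under the arrows starting at `i`. Because the relations have length
two, the only constraints on the prescribed images are that `y a` sits at the target of `a` and that
`c • y a = 0` when `ca ∈ I`. Conversely, such data glue a new vector onto `E`, and a retraction onto
an injective `E` yields `ε`. This is `injective_iff_arrowSolvable`.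

Now embed `M` in an injective `E`; then `M` has injective dimension at most one exactly when `E/M`
is injective. To solve a system in `E/M`, lift its data to `E`. The lift of `y a` may violate the
constraint for `c`, with an error in `M`, and the error can be removed if it lies in `c M`.
Gentleness gives at most one `c` for each `a`, so the corrections do not interfere. This gives the
exactness condition `ArrowExact` (`hasInjectiveDimensionLE_one_iff_arrowExact`).

On a string module every arrow acts as a partial injection of the basis, so exactness is a condition
at each position, the same for sums and products (`arrowExact_iff_exactAt`). At an interior position
two letters leave, and the gentle axioms force exactness (`exactAt_of_leaves`). At an end at most
one letter leaves, and exactness there is the end condition: as relations have length two, whether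
`p l` avoids `I` depends only on `l` and the first arrow of `p` (`endCondition_iff`). -/

noncomputable section

open PathAlgebra

/-! ### One-point extensions of a module and the solvability of arrow equations -/

section Injectivity

variable {k V : Type u} [Field k] [Quiver.{u} V]

theorem PathAlgebra.arrow_eq_ofPath {i j : V} (a : i ⟶ j) :
    arrow k (⟨i, j, a⟩ : Quiver.Total V) = ofPath k a.toPath := rfl

theorem PathAlgebra.ofPath_cons {i j l : V} (p : Quiver.Path i j) (a : j ⟶ l) :
    ofPath k (p.cons a) = arrow k ⟨j, l, a⟩ * ofPath k p := by
  rw [arrow_eq_ofPath, ofPath_mul_ofPath_comp]; rfl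

theorem PathAlgebra.arrow_mul_idem (a : Quiver.Total V) :
    arrow k a * idem k a.left = arrow k a := by
  rw [arrow, idem, ofPath_mul_ofPath_comp, Quiver.Path.nil_comp]

theorem PathAlgebra.idem_mul_arrow (a : Quiver.Total V) :
    idem k a.right * arrow k a = arrow k a := by
  rw [arrow, idem, ofPath_mul_ofPath_comp, Quiver.Path.comp_nil]

theorem PathAlgebra.idem_mul_arrow_of_ne (a : Quiver.Total V) {i : V} (h : a.right ≠ i) :
    idem k i * arrow k a = 0 :=
  ofPath_mul_ofPath_ne _ _ h

theorem PathAlgebra.idem_mul_idem (i : V) : idem k i * idem k i = idem k i := by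
  rw [idem, ofPath_mul_ofPath_comp, Quiver.Path.comp_nil]

theorem PathAlgebra.idem_mul_idem_of_ne {i j : V} (h : i ≠ j) : idem k i * idem k j = 0 :=
  ofPath_mul_ofPath_ne _ _ h.symm

variable [Fintype V]

/-- The projection `kQ → kQ/I`. -/
def TwoSidedIdeal.proj (I : TwoSidedIdeal (PathAlgebra k V)) :
    PathAlgebra k V →+* BoundAlgebra I := I.ringCon.mk'

variable {I : TwoSidedIdeal (PathAlgebra k V)}

theorem TwoSidedIdeal.proj_surjective : Function.Surjective I.proj :=
  I.ringCon.mk'_surjective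

theorem TwoSidedIdeal.proj_eq_zero {r : PathAlgebra k V} (hr : r ∈ I) : I.proj r = 0 := by
  rw [TwoSidedIdeal.mem_iff] at hr
  exact (I.ringCon.eq).2 hr

variable (I) in
/-- Systems of equations `a ε = y a`, for the arrows `a` starting at a given vertex, have solutions in
the module `E` if the obvious necessary conditions hold. -/
def ArrowSolvable (E : Type u) [AddCommGroup E] [Module (BoundAlgebra I) E] : Prop :=
  ∀ (i : V) (y : Quiver.Total V → E),
    (∀ a, a.left = i → I.proj (idem k a.right) • y a = y a) →
    (∀ a c : Quiver.Total V, a.left = i → a.right = c.left → arrow k c * arrow k a ∈ I →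
      I.proj (arrow k c) • y a = 0) →
    ∃ ε : E, I.proj (idem k i) • ε = ε ∧ ∀ a, a.left = i → I.proj (arrow k a) • ε = y a

section OnePointExtension

variable {E : Type u} [AddCommGroup E] [Module (BoundAlgebra I) E]

variable (I E) in
/-- The structure of a vector space on a module over `kQ/I`. -/
abbrev scalarModule : Module k E :=
  Module.compHom E (I.proj.comp (algebraMap k (PathAlgebra k V)))

variable (I E) in
/-- The action of an element of `kQ` on a module over `kQ/I`, as a linear endomorphism. -/
def actionOp (r : PathAlgebra k V) :
    letI := scalarModule I E
    Module.End k E :=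
  letI := scalarModule I E
  { toFun := fun v => I.proj r • v
    map_add' := fun v w => smul_add _ v w
    map_smul' := fun c v => by
      change I.proj r • I.proj (algebraMap k _ c) • v = I.proj (algebraMap k _ c) • I.proj r • v
      rw [← mul_smul, ← mul_smul, ← map_mul, ← map_mul, Algebra.commutes] }

theorem smul_scalar_smul (r : PathAlgebra k V) (c : k) (v : E) :
    letI := scalarModule I E
    I.proj r • c • v = c • I.proj r • v :=
  letI := scalarModule I E
  (actionOp I E r).map_smul' c v

variable (i : V) (y : Quiver.Total V → E)

open Classical in
/-- The action of `e_j` on `E × k`, the second factor being placed at the vertex `i`. -/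
def extIdemOp (j : V) :
    letI := scalarModule I E
    Module.End k (E × k) :=
  letI := scalarModule I E
  { toFun := fun v => (I.proj (idem k j) • v.1, if j = i then v.2 else 0)
    map_add' := fun v w => by by_cases h : j = i <;> simp [h]
    map_smul' := fun c v => by
      refine Prod.ext ((actionOp I E (idem k j)).map_smul c v.1) ?_
      by_cases h : j = i <;> simp [h] }

open Classical in
/-- The action of the arrow `a` on `E × k`: it sends `(0, 1)` to `y a` if it starts at `i`. -/
def extArrowOp (a : Quiver.Total V) :
    letI := scalarModule I E
    Module.End k (E × k) :=
  letI := scalarModule I E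
  { toFun := fun v => (I.proj (arrow k a) • v.1 + if a.left = i then v.2 • y a else 0, 0)
    map_add' := fun v w => by
      by_cases h : a.left = i
      · simp [h, add_smul]; abel
      · simp [h]
    map_smul' := fun c v => by
      refine Prod.ext ?_ (by simp)
      by_cases h : a.left = i
      · simp [h, smul_scalar_smul, mul_smul]
      · simp [h, smul_scalar_smul] }

theorem extIdemOp_apply (j : V) (v : E × k) :
    letI := scalarModule I E
    extIdemOp (I := I) i j v = (I.proj (idem k j) • v.1, open Classical in if j = i then v.2 else 0) :=
  rfl

theorem extArrowOp_apply (a : Quiver.Total V) (v : E × k) :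
    letI := scalarModule I E
    extArrowOp (I := I) i y a v = (I.proj (arrow k a) • v.1 +
      open Classical in if a.left = i then v.2 • y a else 0, 0) :=
  rfl

/-- The representation of `kQ` on `E × k`. -/
def extPathRep (hy : ∀ a, a.left = i → I.proj (idem k a.right) • y a = y a) :
    letI := scalarModule I E
    PathAlgebra k V →ₐ[k] Module.End k (E × k) :=
  letI := scalarModule I E
  PathAlgebra.lift (extIdemOp (I := I) i) (extArrowOp (I := I) i y)
    (fun j => by
      refine LinearMap.ext fun v => ?_
      by_cases h : j = i <;>
        simp [extIdemOp_apply, h, ← mul_smul, ← map_mul, idem_mul_idem])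
    (fun j l hjl => by
      refine LinearMap.ext fun v => ?_
      by_cases h : j = i
      · subst h
        simp [extIdemOp_apply, ← mul_smul, ← map_mul, idem_mul_idem_of_ne hjl, hjl.symm]
      · simp [extIdemOp_apply, h, ← mul_smul, ← map_mul, idem_mul_idem_of_ne hjl])
    (by
      classical
      refine LinearMap.ext fun v => ?_
      rw [LinearMap.sum_apply]
      refine Prod.ext ?_ ?_
      · rw [Prod.fst_sum]
        simp only [extIdemOp_apply]
        rw [← Finset.sum_smul, ← map_sum, ← one_def, map_one, one_smul]; rfl
      · rw [Prod.snd_sum]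
        simp [extIdemOp_apply])
    (fun a => by
      refine LinearMap.ext fun v => ?_
      by_cases h : a.left = i
      · simp [extIdemOp_apply, extArrowOp_apply, h, ← mul_smul, ← map_mul, idem_mul_arrow,
          smul_scalar_smul, hy a h]
      · simp [extIdemOp_apply, extArrowOp_apply, h, ← mul_smul, ← map_mul, idem_mul_arrow])
    (fun a => by
      refine LinearMap.ext fun v => ?_
      have ha := arrow_mul_idem (k := k) a
      by_cases h : a.left = i
      · rw [h] at ha
        simp [extIdemOp_apply, extArrowOp_apply, h, ← mul_smul, ← map_mul, ha]
      · simp [extIdemOp_apply, extArrowOp_apply, h, ← mul_smul, ← map_mul, ha])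

theorem extPathRep_arrow (hy) (a : Quiver.Total V) (v : E × k) :
    letI := scalarModule I E
    extPathRep (I := I) i y hy (arrow k a) v = (I.proj (arrow k a) • v.1 +
      open Classical in if a.left = i then v.2 • y a else 0, 0) := by
  simp only [extPathRep, lift_arrow]
  exact extArrowOp_apply i y a v

/-- This makes `v ↦ (v, 0)` a module homomorphism, so that an injective `E` splits off from `E × k`.
-/
theorem extPathRep_inl (hy) (r : PathAlgebra k V) (v : E) :
    letI := scalarModule I E
    extPathRep (I := I) i y hy r (v, 0) = (I.proj r • v, 0) := by
  let := scalarModule I E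
  induction r using PathAlgebra.induction with
  | zero => simp [Prod.ext_iff]
  | add r s hr hs => simp [hr, hs, add_smul]
  | smul c r hr =>
    rw [map_smul, LinearMap.smul_apply, hr]
    refine Prod.ext ?_ (by simp)
    change I.proj (algebraMap k _ c) • I.proj r • v = I.proj (c • r) • v
    rw [← mul_smul, ← map_mul, Algebra.smul_def]
  | path j l p =>
    induction p with
    | nil =>
      rw [extPathRep, lift_ofPath, pathValue, extIdemOp_apply]
      simp [idem]
    | cons p a ih =>
      rw [ofPath_cons, map_mul, Module.End.mul_apply, ih, extPathRep_arrow, map_mul, mul_smul]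
      simp

variable (hI : IsGentle I) (hy : ∀ a, a.left = i → I.proj (idem k a.right) • y a = y a)
  (hz : ∀ a c : Quiver.Total V, a.left = i → a.right = c.left → arrow k c * arrow k a ∈ I →
      I.proj (arrow k c) • y a = 0)

include hI hz in
-- It suffices to kill the generators `ba` of `I`. They kill `E` already, and they send the new
-- vector to `b • y a`, which is zero by `hz`.
theorem extPathRep_eq_zero (r : PathAlgebra k V) (hr : r ∈ I) :
    letI := scalarModule I E
    extPathRep (I := I) i y hy r = 0 := by
  let := scalarModule I E
  obtain ⟨R, hR', hR⟩ := hI.generated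
  have hker : I ≤ TwoSidedIdeal.ker (extPathRep (I := I) i y hy) := by
    conv_lhs => rw [hR]
    rw [TwoSidedIdeal.span_le]
    rintro _ ⟨⟨b, a⟩, hba, rfl⟩
    have hmem : arrow k b * arrow k a ∈ I := by
      rw [hR]
      exact TwoSidedIdeal.subset_span ⟨⟨b, a⟩, hba, rfl⟩
    rw [SetLike.mem_coe, TwoSidedIdeal.mem_ker, map_mul]
    refine LinearMap.ext fun v => ?_
    rw [Module.End.mul_apply, extPathRep_arrow, extPathRep_arrow]
    have h0 : I.proj (arrow k b) • I.proj (arrow k a) • v.1 = 0 := by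
      rw [← mul_smul, ← map_mul, TwoSidedIdeal.proj_eq_zero hmem, zero_smul]
    by_cases h : a.left = i
    · simp [h, h0, smul_scalar_smul, hz a b h (hR' _ hba) hmem]
    · simp [h, h0]
  exact (TwoSidedIdeal.mem_ker _).mp (hker hr)

/-- The representation of `kQ/I` on `E × k`. -/
def extRep :
    letI := scalarModule I E
    BoundAlgebra I →+* Module.End k (E × k) :=
  letI := scalarModule I E
  I.ringCon.lift (extPathRep (I := I) i y hy : PathAlgebra k V →+* Module.End k (E × k)) (by
    intro r s hrs
    rw [TwoSidedIdeal.rel_iff] at hrs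
    have := extPathRep_eq_zero i y hI hy hz _ hrs
    rw [map_sub, sub_eq_zero] at this
    exact this)

include hI in
-- Retract the one-point extension `E × k` onto `E`: the image of the new vector `(0, 1)` solves the
-- equations, since an arrow `a` starting at `i` sends `(0, 1)` to `(y a, 0)`, which retracts to `y
-- a`.
theorem arrowSolvable_of_injective [hE : Module.Injective (BoundAlgebra I) E] :
    ArrowSolvable I E := by
  intro i y hy hz
  let := scalarModule I E
  let : Module (BoundAlgebra I) (E × k) := Module.compHom (E × k) (extRep i y hI hy hz)
  have smul_def (r : PathAlgebra k V) (v : E × k) :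
    I.proj r • v = extPathRep (I := I) i y hy r v := rfl
  let inl : E →ₗ[BoundAlgebra I] E × k :=
    { toFun := fun v => (v, 0)
      map_add' := fun v w => by simp
      map_smul' := fun r v => by
        obtain ⟨r, rfl⟩ := TwoSidedIdeal.proj_surjective r
        exact (extPathRep_inl i y hy r v).symm }
  obtain ⟨ρ, hρ⟩ := hE.out inl (fun v w h => congrArg Prod.fst h) LinearMap.id
  -- The factor `e_i` places the solution at the vertex `i`; it does not change the images under
  -- arrows starting at `i`.
  refine ⟨I.proj (idem k i) • ρ (0, 1), ?_, fun a ha => ?_⟩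
  · rw [← mul_smul, ← map_mul, idem_mul_idem]
  · rw [← mul_smul, ← map_mul, ← ha, arrow_mul_idem, ← map_smul, smul_def, extPathRep_arrow]
    refine Eq.trans ?_ (hρ (y a))
    simp [ha, inl]

end OnePointExtension

end Injectivity

/-! ### Baer-type criterion: extending a map by one vector at a time -/

section InjectivityCriterion

variable {k V : Type u} [Field k] [Quiver.{u} V] [Fintype V]
  {I : TwoSidedIdeal (PathAlgebra k V)} {N E : Type u} [AddCommGroup N] [AddCommGroup E]
  [Module (BoundAlgebra I) N] [Module (BoundAlgebra I) E]

/-- This says that `N/L` has nonzero socle. Otherwise, any vector outside `L` could be pushed along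
arrows without ever entering `L`, giving paths of every length that act nontrivially, against
nilpotency. -/
theorem exists_arrow_smul_mem (hI : IsGentle I) (L : Submodule (BoundAlgebra I) N) (hL : L ≠ ⊤) :
    ∃ (i : V) (x : N), I.proj (idem k i) • x = x ∧ x ∉ L ∧
      ∀ a : Quiver.Total V, a.left = i → I.proj (arrow k a) • x ∈ L := by
  obtain ⟨x, -, hx⟩ := SetLike.exists_of_lt (lt_top_iff_ne_top.mpr hL)
  obtain ⟨m, hm⟩ := hI.nilpotent
  by_contra! h
  have key (n : ℕ) : ∃ (i j : V) (p : Quiver.Path i j), p.length = n ∧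
      I.proj (ofPath k p) • x ∉ L := by
    induction n with
    | zero =>
      by_contra! h0
      refine hx ?_
      rw [← one_smul (BoundAlgebra I) x, ← map_one I.proj, one_def, map_sum, Finset.sum_smul]
      exact Submodule.sum_mem _ fun i _ => h0 i i Quiver.Path.nil rfl
    | succ n ih =>
      obtain ⟨i, j, p, hp, hpx⟩ := ih
      obtain ⟨a, ha, hax⟩ := h j (I.proj (ofPath k p) • x)
        (by rw [← mul_smul, ← map_mul, idem, ofPath_mul_ofPath_comp, Quiver.Path.comp_nil]) hpx
      obtain ⟨j', l, a⟩ := a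
      obtain rfl : j' = j := ha
      refine ⟨i, l, p.cons a, by simp [hp], ?_⟩
      rwa [ofPath_cons, map_mul, mul_smul]
  obtain ⟨i, j, p, hp, hpx⟩ := key m
  exact hpx (by rw [TwoSidedIdeal.proj_eq_zero (hm i j p hp.ge), zero_smul]; exact L.zero_mem)

/-- Modulo `L` the vector `z` spans a submodule of dimension at most one: every path of positive
length sends `z` into `L`, and among trivial paths only `e_i` can act nontrivially. -/
theorem exists_smul_sub_smul_mem (L : Submodule (BoundAlgebra I) N) {i : V} {z : N}
    (hz : I.proj (idem k i) • z = z)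
    (harrow : ∀ a : Quiver.Total V, a.left = i → I.proj (arrow k a) • z ∈ L)
    (r : PathAlgebra k V) : ∃ c : k, I.proj r • z - I.proj (c • 1) • z ∈ L := by
  have idem_ne {j : V} (h : i ≠ j) : I.proj (idem k j) • z = 0 := by
    rw [← hz, ← mul_smul, ← map_mul, idem_mul_idem_of_ne h.symm, map_zero, zero_smul]
  have hpath {j l : V} (p : Quiver.Path j l) (hp : p.length ≠ 0) : I.proj (ofPath k p) • z ∈ L := by
    induction p with
    | nil => simp at hp
    | @cons l m p a ih =>
      by_cases h0 : p.length = 0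
      · obtain rfl := Quiver.Path.eq_of_length_zero p h0
        obtain rfl := Quiver.Path.eq_nil_of_length_zero p h0
        by_cases hji : i = j
        · exact harrow ⟨j, _, a⟩ hji.symm
        · rw [ofPath_cons, map_mul, mul_smul]
          exact L.smul_mem _ ((idem_ne hji).symm ▸ L.zero_mem)
      · rw [ofPath_cons, map_mul, mul_smul]
        exact L.smul_mem _ (ih h0)
  induction r using PathAlgebra.induction with
  | zero => exact ⟨0, by simp⟩
  | add r s hr hs =>
    obtain ⟨c, h⟩ := hr
    obtain ⟨d, g⟩ := hs
    refine ⟨c + d, ?_⟩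
    convert! L.add_mem h g using 1
    simp only [add_smul, map_add]
    abel
  | smul d r hr =>
    obtain ⟨c, h⟩ := hr
    refine ⟨d * c, ?_⟩
    convert! L.smul_mem (I.proj (d • 1)) h using 1
    rw [smul_sub, ← mul_smul, ← mul_smul, ← map_mul, ← map_mul, smul_one_mul, smul_one_mul,
      smul_smul]
  | path j l p =>
    by_cases h0 : p.length = 0
    · obtain rfl := Quiver.Path.eq_of_length_zero p h0
      obtain rfl := Quiver.Path.eq_nil_of_length_zero p h0
      by_cases hji : i = j
      · subst hji
        refine ⟨1, ?_⟩
        rw [one_smul, map_one, one_smul, ← idem, hz, sub_self]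
        exact L.zero_mem
      · refine ⟨0, ?_⟩
        rw [zero_smul, map_zero, zero_smul, ← idem, idem_ne hji, sub_self]
        exact L.zero_mem
    · exact ⟨0, by simpa using hpath p h0⟩

/-- This is the compatibility needed to extend `f` by `x ↦ ε`: the arrow equations control every
multiple of `x` that falls in the domain. -/
theorem apply_smul_eq_of_arrow (f : N →ₗ.[BoundAlgebra I] E) {i : V} {x : N} {ε : E}
    (hx : I.proj (idem k i) • x = x) (hε : I.proj (idem k i) • ε = ε) (hxf : x ∉ f.domain)
    (harrow : ∀ a : Quiver.Total V, a.left = i →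
      ∃ h : I.proj (arrow k a) • x ∈ f.domain, f ⟨_, h⟩ = I.proj (arrow k a) • ε)
    (r : BoundAlgebra I) (hr : r • x ∈ f.domain) : f ⟨r • x, hr⟩ = r • ε := by
  obtain ⟨r, rfl⟩ := TwoSidedIdeal.proj_surjective r
  -- Working in `N × E` with the graph of `f` as submodule, the hypothesis on arrows says that every
  -- arrow starting at `i` sends `(x, ε)` into the graph. Hence `r` acts on `(x, ε)` as a scalar `c`
  -- modulo the graph.
  obtain ⟨c, h⟩ := exists_smul_sub_smul_mem f.graph (z := (x, ε)) (Prod.ext hx hε) (fun a ha => by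
    obtain ⟨h, h'⟩ := harrow a ha
    exact (LinearPMap.mem_graph_iff f).mpr ⟨⟨_, h⟩, rfl, h'⟩) r
  -- If `c` were invertible, `r • x` being in the domain would put `x` itself there.
  have hc : c = 0 := by
    by_contra hc
    obtain ⟨⟨_, hy⟩, rfl, -⟩ := (LinearPMap.mem_graph_iff f).mp h
    have := f.domain.smul_mem (I.proj (c⁻¹ • 1)) ((f.domain.sub_mem_iff_right hr).mp hy)
    rw [Prod.smul_mk, ← mul_smul, ← map_mul, smul_one_mul, smul_smul, inv_mul_cancel₀ hc,
      one_smul, map_one, one_smul] at this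
    exact hxf this
  subst hc
  rw [zero_smul, map_zero, zero_smul, sub_zero] at h
  obtain ⟨y, hy, hy'⟩ := (LinearPMap.mem_graph_iff f).mp h
  obtain rfl : y = ⟨_, hr⟩ := Subtype.ext hy
  exact hy'

/-- A maximal extension of `g` is defined everywhere: otherwise a vector outside its domain, with
all arrow images inside, could be added by solving the arrow equations for a value `ε`. -/
theorem injective_of_arrowSolvable (hI : IsGentle I) (hE : ArrowSolvable I E) :
    Module.Injective (BoundAlgebra I) E where
  out X Y _ _ _ _ i hi g := by
    have : Fact (Function.Injective i) := ⟨hi⟩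
    let F := Module.Baer.extensionOfMax i g
    have htop : F.domain = ⊤ := by
      by_contra hF
      obtain ⟨j, x, hx, hxF, hax⟩ := exists_arrow_smul_mem hI F.domain hF
      classical
      -- The prescribed images are the values of `F` at `a • x`; both constraints follow by
      -- linearity of `F`. The value `0` for arrows not starting at `j` plays no role.
      obtain ⟨ε, hε, hε'⟩ := hE j
        (fun a => if h : a.left = j then F.toLinearPMap ⟨_, hax a h⟩ else 0) (by
          intro a ha
          simp only [ha, dif_pos]
          rw [← LinearPMap.map_smul]
          congr 1
          ext
          simp only [SetLike.mk_smul_mk]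
          rw [← mul_smul, ← map_mul, idem_mul_arrow]) (by
          intro a c ha hac hca
          simp only [ha, dif_pos]
          rw [← LinearPMap.map_smul, ← F.toLinearPMap.map_zero]
          congr 1
          ext
          simp only [SetLike.mk_smul_mk]
          rw [← mul_smul, ← map_mul, TwoSidedIdeal.proj_eq_zero hca, zero_smul]; rfl)
      have key := apply_smul_eq_of_arrow F.toLinearPMap hx hε hxF
        (fun a ha => ⟨hax a ha, by rw [hε' a ha, dif_pos ha]⟩)
      let G : Y →ₗ.[BoundAlgebra I] E := LinearPMap.mkSpanSingleton' x ε (by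
        intro r hr
        rw [RingHom.id_apply, ← key r (hr ▸ F.domain.zero_mem), ← F.toLinearPMap.map_zero]
        congr 1
        exact Subtype.ext hr)
      have hFG : ∀ (v : F.domain) (w : G.domain), (v : Y) = w → F.toLinearPMap v = G w := by
        rintro ⟨v, hv⟩ ⟨w, hw⟩ (rfl : v = w)
        obtain ⟨r, rfl⟩ := Submodule.mem_span_singleton.mp hw
        rw [LinearPMap.mkSpanSingleton'_apply, key]; rfl
      let H : Module.Baer.ExtensionOf i g :=
        { F.toLinearPMap.sup G hFG with
          le := F.le.trans (LinearPMap.left_le_sup _ _ hFG).1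
          is_extension := fun m => (F.is_extension m).trans
            ((LinearPMap.left_le_sup _ _ hFG).2 rfl) }
      have hH : H = F := Module.Baer.extensionOfMax_is_max i g H (LinearPMap.left_le_sup _ _ hFG)
      refine hxF ?_
      rw [← hH]
      exact (LinearPMap.right_le_sup _ _ hFG).1 (Submodule.mem_span_singleton_self x)
    refine ⟨F.toLinearPMap.toFun ∘ₗ (LinearEquiv.ofTop _ htop).symm.toLinearMap, fun x => ?_⟩
    exact (F.is_extension x).symm

theorem injective_iff_arrowSolvable (hI : IsGentle I) :
    Module.Injective (BoundAlgebra I) E ↔ ArrowSolvable I E :=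
  ⟨fun _ => arrowSolvable_of_injective hI, injective_of_arrowSolvable hI⟩

end InjectivityCriterion

/-! ### Injective dimension at most one as exactness along relations -/

section InjectiveDimension

variable {k V : Type u} [Field k] [Quiver.{u} V] [Fintype V]
  {I : TwoSidedIdeal (PathAlgebra k V)}

variable (I) in
/-- If `c` is an arrow such that `ca ∈ I` for some arrow `a`, then the sequence of the actions of `c`
and of the arrows `d` such that `dc ∈ I` is exact. -/
def ArrowExact (M : Type u) [AddCommGroup M] [Module (BoundAlgebra I) M] : Prop :=
  ∀ a c : Quiver.Total V, a.right = c.left → arrow k c * arrow k a ∈ I →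
    ∀ m : M, I.proj (idem k c.right) • m = m →
      (∀ d : Quiver.Total V, c.right = d.left → arrow k d * arrow k c ∈ I →
        I.proj (arrow k d) • m = 0) →
      ∃ m' : M, I.proj (arrow k c) • m' = m

variable {M E : Type u} [AddCommGroup M] [AddCommGroup E]
  [Module (BoundAlgebra I) M] [Module (BoundAlgebra I) E]

/-- The data in the quotient are lifted to data satisfying the constraints in `E`; the system is
solved there and the solution projected back. -/
theorem arrowSolvable_quotient (hI : IsGentle I) (hE : ArrowSolvable I E) (f : M →ₗ[BoundAlgebra I] E)
    (hf : Function.Injective f) (hM : ArrowExact I M) :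
    ArrowSolvable I (E ⧸ LinearMap.range f) := by
  intro i y hy hz
  have lift (a : Quiver.Total V) : ∃ e : E, a.left = i →
      (LinearMap.range f).mkQ e = y a ∧ I.proj (idem k a.right) • e = e ∧
        ∀ c : Quiver.Total V, a.right = c.left → arrow k c * arrow k a ∈ I →
          I.proj (arrow k c) • e = 0 := by
    by_cases ha : a.left = i
    swap
    · exact ⟨0, fun h => absurd h ha⟩
    obtain ⟨e, he⟩ := (LinearMap.range f).mkQ_surjective (y a)
    -- At most one `c` satisfies `ca ∈ I`, so one correction is enough; if there is none, projecting
    -- to the right vertex suffices.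
    by_cases hc : ∃ c : Quiver.Total V, a.right = c.left ∧ arrow k c * arrow k a ∈ I
    swap
    · refine ⟨I.proj (idem k a.right) • e, fun _ => ⟨?_, ?_, fun c h h' => absurd ⟨c, h, h'⟩ hc⟩⟩
      · rw [map_smul, he, hy a ha]
      · rw [← mul_smul, ← map_mul, idem_mul_idem]
    obtain ⟨c, hac, hca⟩ := hc
    have hce : I.proj (arrow k c) • e ∈ LinearMap.range f := by
      rw [← Submodule.Quotient.mk_eq_zero, ← Submodule.mkQ_apply, map_smul, he, hz a c ha hac hca]
    obtain ⟨m, hm⟩ := hce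
    -- The error `c • e = f m` is killed by every `d` with `dc ∈ I`, so exactness gives `m = c •
    -- m'`, and `e - f m'` is a lift killed by `c`.
    obtain ⟨m', hm'⟩ := hM a c hac hca m
      (hf (by rw [map_smul, hm, ← mul_smul, ← map_mul, idem_mul_arrow])) (fun d _ hdc =>
        hf (by rw [map_smul, hm, ← mul_smul, ← map_mul, TwoSidedIdeal.proj_eq_zero hdc, zero_smul,
          map_zero]))
    refine ⟨I.proj (idem k a.right) • (e - f m'), fun _ => ⟨?_, ?_, fun c' hac' hca' => ?_⟩⟩
    · have : (LinearMap.range f).mkQ (f m') = 0 := by simp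
      rw [map_smul, map_sub, he, this, sub_zero, hy a ha]
    · rw [← mul_smul, ← map_mul, idem_mul_idem]
    · obtain rfl := hI.unique_left_zero a c c' hac.symm hac'.symm hca hca'
      rw [← mul_smul, ← map_mul, hac, arrow_mul_idem, smul_sub, ← map_smul, hm', hm, sub_self]
  choose e he using lift
  obtain ⟨ε, hε, hε'⟩ := hE i e (fun a ha => (he a ha).2.1) (fun a c ha => (he a ha).2.2 c)
  refine ⟨(LinearMap.range f).mkQ ε, ?_, fun a ha => ?_⟩
  · rw [← map_smul, hε]
  · rw [← map_smul, hε' a ha, (he a ha).1]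

/-- Solve `c • e = f m` in `E`, with the other arrows starting at `c.left` killing `e`. The class of
`e` is then killed by all these arrows, so it equals `a • ε` in the quotient. Thus `e - a • ε` comes
from `M`, and `c` sends it to `f m` because `ca ∈ I`. -/
theorem arrowExact_of_arrowSolvable_quotient (hE : ArrowSolvable I E) (f : M →ₗ[BoundAlgebra I] E)
    (hf : Function.Injective f) (hC : ArrowSolvable I (E ⧸ LinearMap.range f)) :
    ArrowExact I M := by
  classical
  intro a c hac hca m hm hdm
  obtain ⟨e, he, hce⟩ := hE c.left (fun b => if b = c then f m else 0)
    (fun b _ => by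
      by_cases hb : b = c
      · subst hb
        simp only [if_true]
        rw [← map_smul, hm]
      · simp [hb])
    (fun b d _ hbd hdb => by
      by_cases hb : b = c
      · subst hb
        simp only [if_true]
        rw [← map_smul, hdm d hbd hdb, map_zero]
      · simp [hb])
  have hce' (b : Quiver.Total V) (hb : b.left = c.left) :
      I.proj (arrow k b) • (LinearMap.range f).mkQ e = 0 := by
    rw [← map_smul, hce b hb]
    by_cases hbc : b = c <;> simp [hbc]
  obtain ⟨ε, -, hε⟩ := hC a.left (fun b => if b = a then (LinearMap.range f).mkQ e else 0)
    (fun b _ => by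
      by_cases hb : b = a
      · subst hb
        simp only [if_true]
        rw [← map_smul, hac, he]
      · simp [hb])
    (fun b d _ hbd hdb => by
      by_cases hb : b = a
      · subst hb
        simp only [if_true]
        exact hce' d (hbd.symm.trans hac)
      · simp [hb])
  obtain ⟨ε, rfl⟩ := (LinearMap.range f).mkQ_surjective ε
  have h := hε a rfl
  rw [if_pos rfl, ← map_smul, ← sub_eq_zero, ← map_sub, Submodule.mkQ_apply,
    Submodule.Quotient.mk_eq_zero] at h
  obtain ⟨m', hm'⟩ := h
  refine ⟨-m', hf ?_⟩
  rw [map_smul, map_neg, hm', neg_sub, smul_sub, hce c rfl, if_pos rfl, ← mul_smul, ← map_mul,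
    TwoSidedIdeal.proj_eq_zero hca, zero_smul, sub_zero]

open CategoryTheory in
-- Dimension shifting along an embedding of `M` into an injective module `E` reduces the claim to
-- injectivity of the cokernel.
theorem hasInjectiveDimensionLE_one_iff_arrowExact (hI : IsGentle I)
    (M : ModuleCat.{u} (BoundAlgebra I)) : HasInjectiveDimensionLE M 1 ↔ ArrowExact I M := by
  let ⟨E, _, f, _⟩ := EnoughInjectives.presentation M
  have hf : Function.Injective f.hom := (ModuleCat.mono_iff_injective f).mp ‹_›
  let S : ShortComplex (ModuleCat.{u} (BoundAlgebra I)) :=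
    ModuleCat.shortComplexOfCompEqZero _ _ f.hom.exact_map_mkQ_range.linearMap_comp_eq_zero
  have hS : S.ShortExact := ModuleCat.shortComplex_shortExact S
    f.hom.exact_map_mkQ_range hf (Submodule.mkQ_surjective _)
  have hE : ArrowSolvable I E := (injective_iff_arrowSolvable hI).mp
    ((Module.injective_iff_injective_object _ E).mpr ‹_›)
  have key : HasInjectiveDimensionLE M 1 ↔ ArrowSolvable I (E ⧸ LinearMap.range f.hom) := by
    rw [← injective_iff_arrowSolvable hI, Module.injective_iff_injective_object,
      injective_iff_hasInjectiveDimensionLT_one]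
    exact (hS.hasInjectiveDimensionLT_X₃_iff 0 ‹_›).symm
  rw [key]
  exact ⟨arrowExact_of_arrowSolvable_quotient hE f.hom hf,
    arrowSolvable_quotient hI hE f.hom hf⟩

end InjectiveDimension

/-! ### Exactness of a string module, position by position -/

section DiagramModules

variable {k V : Type u} [Field k] [Quiver.{u} V] [Fintype V]
  {I : TwoSidedIdeal (PathAlgebra k V)}

namespace StringDiagram

variable (D : StringDiagram I)

/-- Each arrow acts as a partial injection on the positions. -/
structure IsPartialInjective : Prop where
  pred_unique : ∀ a x x' y, D.step a x y → D.step a x' y → x = x'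
  succ_unique : ∀ a x y y', D.step a x y → D.step a x y' → y = y'

/-- The combinatorial form, at the position `x`, of the condition `ArrowExact`. -/
def ExactAt (x : D.P) : Prop :=
  ∀ a c : Quiver.Total V, a.right = c.left → arrow k c * arrow k a ∈ I → D.vertex x = c.right →
    (∃ d y, D.step d x y ∧ arrow k d * arrow k c ∈ I) ∨ ∃ z, D.step c z x

theorem pathRep_arrow (a : Quiver.Total V) : D.pathRep (arrow k a) = D.arrowOp a := by
  rw [pathRep, lift_arrow]

theorem pathRep_idem (i : V) : D.pathRep (idem k i) = D.idemOp i := by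
  rw [pathRep, idem, lift_ofPath, pathValue]

open Classical in
theorem idemOp_apply (i : V) (f : D.P → k) (x : D.P) :
    D.idemOp i f x = if D.vertex x = i then f x else 0 := rfl

theorem arrowOp_apply (a : Quiver.Total V) (f : D.P → k) (y : D.P) :
    D.arrowOp a f y = ∑ x ∈ (D.finite_preds a y).toFinset, f x := rfl

theorem arrowOp_apply_of_forall_not {a : Quiver.Total V} {y : D.P} (h : ∀ x, ¬ D.step a x y)
    (f : D.P → k) : D.arrowOp a f y = 0 := by
  rw [arrowOp_apply]
  exact Finset.sum_eq_zero fun x hx => absurd (by simpa using hx) (h x)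

variable {D} in
theorem IsPartialInjective.arrowOp_apply_of_step (hD : D.IsPartialInjective) {a : Quiver.Total V}
    {x y : D.P} (h : D.step a x y) (f : D.P → k) : D.arrowOp a f y = f x := by
  rw [arrowOp_apply]
  refine Finset.sum_eq_single_of_mem x (by simpa using h) fun z hz hzx => ?_
  exact absurd (hD.pred_unique a z x y (by simpa using hz) h) hzx

open Classical in
/-- The family obtained by moving the entries of `f` back along the arrow `a`. -/
def pullBack (a : Quiver.Total V) (f : D.P → k) (x : D.P) : k :=
  if h : ∃ y, D.step a x y then f h.choose else 0

variable {D} in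
theorem IsPartialInjective.pullBack_apply_of_step (hD : D.IsPartialInjective) {a : Quiver.Total V}
    {x y : D.P} (h : D.step a x y) (f : D.P → k) : D.pullBack a f x = f y := by
  have hx : ∃ y, D.step a x y := ⟨y, h⟩
  rw [pullBack, dif_pos hx, hD.succ_unique a x _ y hx.choose_spec h]

/-- With this, the preimage used to prove exactness of the product also serves for the sum. -/
theorem finite_support_pullBack (a : Quiver.Total V) {f : D.P → k} (hf : f.support.Finite) :
    (D.pullBack a f).support.Finite := by
  refine (hf.biUnion fun y _ => D.finite_preds a y).subset fun x hx => ?_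
  rw [Function.mem_support, pullBack] at hx
  split_ifs at hx with h
  · exact Set.mem_biUnion hx h.choose_spec
  · exact absurd rfl hx

/-- The map `ι` allows one argument for both products and sums. Exactness is tested on basis vectors
in one direction; in the other, pulling back along `c` produces the required preimage. -/
theorem arrowExact_iff_exactAt (hD : D.IsPartialInjective) {M : Type u} [AddCommGroup M]
    [Module (BoundAlgebra I) M] (ι : M → D.P → k) (hι : Function.Injective ι) (h_zero : ι 0 = 0)
    (h_smul : ∀ r m, ι (I.proj r • m) = D.pathRep r (ι m))
    (h_single : ∀ x, open Classical in ∃ m, ι m = Pi.single x 1)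
    (h_pullBack : ∀ a m, ∃ m', ι m' = D.pullBack a (ι m)) :
    ArrowExact I M ↔ ∀ x, D.ExactAt x := by
  classical
  constructor
  · intro h x a c hac hca hx
    by_contra! hcon
    obtain ⟨hd, hc⟩ := hcon
    obtain ⟨m, hm⟩ := h_single x
    obtain ⟨m', hm'⟩ := h a c hac hca m (hι (by
        rw [h_smul, hm, pathRep_idem]
        ext y
        rw [idemOp_apply]
        by_cases hy : y = x
        · subst hy; rw [if_pos hx]
        · simp [hy])) (fun d hcd hdc => hι (by
        rw [h_smul, hm, pathRep_arrow, h_zero]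
        ext y
        rw [arrowOp_apply]
        refine Finset.sum_eq_zero fun z hz => Pi.single_eq_of_ne ?_ _
        rintro rfl
        exact hd d y (by simpa using hz) hdc))
    have := congrFun (congrArg ι hm') x
    rw [h_smul, hm, pathRep_arrow, D.arrowOp_apply_of_forall_not hc, Pi.single_eq_same] at this
    exact zero_ne_one this
  · intro h a c hac hca m hm hdm
    obtain ⟨m', hm'⟩ := h_pullBack c m
    refine ⟨m', hι ?_⟩
    rw [h_smul, hm', pathRep_arrow]
    ext y
    by_cases hy : ∃ z, D.step c z y
    · obtain ⟨z, hz⟩ := hy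
      rw [hD.arrowOp_apply_of_step hz, hD.pullBack_apply_of_step hz]
    · rw [D.arrowOp_apply_of_forall_not (not_exists.mp hy)]
      -- At a position not reached by `c` the entry of `m` must vanish: either the position is at
      -- the wrong vertex, or an arrow `d` with `dc ∈ I` carries the entry injectively to an entry
      -- of `d • m = 0`.
      by_cases hv : D.vertex y = c.right
      · obtain ⟨d, z, hz, hdc⟩ := (h y a c hac hca hv).resolve_right hy
        have := congrFun (congrArg ι (hdm d (hv.symm.trans (D.step_source d y z hz)) hdc)) z
        rw [h_smul, pathRep_arrow, hD.arrowOp_apply_of_step hz, h_zero] at this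
        exact this.symm
      · have := congrFun (congrArg ι hm) y
        rwa [h_smul, pathRep_idem, idemOp_apply, if_neg hv] at this

variable (hI : IsGentle I)

open Classical in
theorem arrowExact_prodModule_iff (hD : D.IsPartialInjective) :
    ArrowExact I (D.prodModule hI) ↔ ∀ x, D.ExactAt x :=
  D.arrowExact_iff_exactAt hD (M := D.prodModule hI) (fun f => f) (fun _ _ h => h) rfl
    (fun _ _ => rfl) (fun _ => ⟨_, rfl⟩) (fun _ _ => ⟨_, rfl⟩)

open Classical in
theorem arrowExact_sumModule_iff (hD : D.IsPartialInjective) :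
    ArrowExact I (D.sumModule hI) ↔ ∀ x, D.ExactAt x :=
  D.arrowExact_iff_exactAt hD (M := D.sumModule hI) (fun f => f.1) (fun _ _ h => Subtype.ext h) rfl
    (fun _ _ => rfl)
    (fun x => ⟨⟨Pi.single x 1, (Set.finite_singleton x).subset fun y hy => by
      by_contra h
      exact hy (Pi.single_eq_of_ne h 1)⟩, rfl⟩)
    (fun a f => ⟨⟨_, D.finite_support_pullBack a f.2⟩, rfl⟩)

/-- At the position `x`, the diagram can be left along the letter `l`. -/
def Leaves (x : D.P) : Letter V → Prop
  | .direct a => ∃ y, D.step a x y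
  | .inverse a => ∃ y, D.step a y x

variable {D} in
include hI in
-- Two outgoing arrows are distinct, so they cannot both compose with `c` to a path outside `I`. If
-- `d` leaves and `c'` arrives with `dc' ∉ I`, then `dc ∈ I` or `c = c'`. Two arriving arrows are
-- distinct and exhaust the arrows ending at the vertex, so `c` is one of them.
theorem exactAt_of_leaves {x : D.P} {l l' : Letter V} (h : D.Leaves x l) (h' : D.Leaves x l')
    (hc : l.inv.Compatible I l') : D.ExactAt x := by
  intro a c hac hca hx
  by_contra! hcon
  obtain ⟨hd, hp⟩ := hcon
  cases l with
  | direct d =>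
    obtain ⟨y, hy⟩ := h
    have hdc := hd d y hy
    have hd_left := D.step_source _ _ _ hy
    cases l' with
    | direct d' =>
      obtain ⟨y', hy'⟩ := h'
      refine hc.1 (congrArg _ ?_)
      exact hI.unique_left_nonzero c d' d ((D.step_source _ _ _ hy').symm.trans hx)
        (hd_left.symm.trans hx) (hd d' y' hy') hdc
    | inverse c' =>
      obtain ⟨y', hy'⟩ := h'
      obtain rfl := hI.unique_right_nonzero d c c' (hx.symm.trans hd_left)
        ((D.step_target _ _ _ hy').symm.trans hd_left) hdc (hc.2.2 _ _ rfl rfl)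
      exact hp _ hy'
  | inverse c' =>
    obtain ⟨y, hy⟩ := h
    cases l' with
    | direct d =>
      obtain ⟨y', hy'⟩ := h'
      obtain rfl := hI.unique_right_nonzero d c c' (hx.symm.trans (D.step_source _ _ _ hy'))
        ((D.step_target _ _ _ hy).symm.trans (D.step_source _ _ _ hy')) (hd d y' hy')
        (hc.2.1 _ _ rfl rfl)
      exact hp _ hy
    | inverse c'' =>
      obtain ⟨y', hy'⟩ := h'
      have h1 : c ≠ c' := fun h => hp y (h ▸ hy)
      have h2 : c ≠ c'' := fun h => hp y' (h ▸ hy')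
      have h3 : c' ≠ c'' := fun h => hc.1 (by rw [h]; rfl)
      have hsub : ({c, c', c''} : Set (Quiver.Total V)) ⊆ {b | b.right = D.vertex x} := by
        rintro b (rfl | rfl | rfl)
        · exact hx.symm
        · exact (D.step_target _ _ _ hy).symm
        · exact (D.step_target _ _ _ hy').symm
      have hle := (Set.encard_le_encard hsub).trans (hI.incoming _)
      rw [Set.encard_insert_of_notMem (by simp [h1, h2]), Set.encard_pair h3] at hle
      exact absurd hle (by norm_num)

end StringDiagram

end DiagramModules

/-! ### Paths outside the ideal and the local form of the end condition -/

section EndConditions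

variable {k V : Type u} [Field k] [Quiver.{u} V]

theorem pathProduct_concat (i : V) (p : List (Quiver.Total V)) (a : Quiver.Total V) :
    pathProduct k i (p ++ [a]) = arrow k a * pathProduct k i p := by
  simp [pathProduct]

variable [Fintype V] {I : TwoSidedIdeal (PathAlgebra k V)}

theorem foldl_arrow_mul (p : List (Quiver.Total V)) (r s : PathAlgebra k V) :
    p.foldl (fun r a => arrow k a * r) r * s = p.foldl (fun r a => arrow k a * r) (r * s) := by
  induction p generalizing r with
  | nil => rfl
  | cons a p ih => rw [List.foldl_cons, List.foldl_cons, ih, mul_assoc]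

theorem foldl_arrow_mem (p : List (Quiver.Total V)) {r : PathAlgebra k V} (hr : r ∈ I) :
    p.foldl (fun r a => arrow k a * r) r ∈ I := by
  induction p generalizing r with
  | nil => exact hr
  | cons a p ih => exact ih (I.mul_mem_left _ _ hr)

theorem pathProduct_mul_arrow (p : List (Quiver.Total V)) (l : Quiver.Total V) :
    pathProduct k l.right p * arrow k l = pathProduct k l.left (l :: p) := by
  rw [pathProduct, foldl_arrow_mul, idem_mul_arrow, pathProduct, List.foldl_cons, arrow_mul_idem]

theorem pathProduct_eq_ofPath (i : V) (p : List (Quiver.Total V)) :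
    pathProduct k i p = 0 ∨
      ∃ (j : V) (q : Quiver.Path i j), q.length = p.length ∧ pathProduct k i p = ofPath k q := by
  induction p using List.reverseRecOn with
  | nil => exact Or.inr ⟨i, Quiver.Path.nil, rfl, rfl⟩
  | append_singleton p a ih =>
    rw [pathProduct_concat]
    obtain h | ⟨j, q, hq, h⟩ := ih
    · exact Or.inl (by rw [h, mul_zero])
    · obtain ⟨j', l, a⟩ := a
      rw [h]
      by_cases hj : j = j'
      · subst hj
        exact Or.inr ⟨l, q.cons a, by simp [hq], (ofPath_cons q a).symm⟩
      · exact Or.inl (ofPath_mul_ofPath_ne _ _ hj)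

variable (I) in
/-- The diagram of a sequence of composable direct letters. -/
def pathDiagram (i : V) (q : List (Quiver.Total V)) (h_start : ∀ a, q[0]? = some a → a.left = i)
    (h_next : ∀ n a b, q[n]? = some a → q[n + 1]? = some b →
      b.left = a.right ∧ arrow k b * arrow k a ∉ I) : StringDiagram I where
  P := ℕ
  -- Positions beyond the end of `q` get the default vertex `i`; no step enters or leaves them.
  vertex n := if n = 0 then i else (q[n - 1]?).elim i (fun a => a.right)
  step a x y := y = x + 1 ∧ q[x]? = some a
  step_source := by
    rintro a x y ⟨rfl, h⟩
    rcases x with _ | x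
    · simpa using (h_start a h).symm
    · have hx : x < q.length := by
        have := (List.getElem?_eq_some_iff.mp h).1
        omega
      have hx' := List.getElem?_eq_getElem hx
      simpa [hx'] using (h_next x _ a hx' h).1.symm
  step_target := by
    rintro a x y ⟨rfl, h⟩
    simp [h]
  step_step := by
    rintro a b x y z ⟨rfl, h⟩ ⟨rfl, h'⟩
    exact (h_next x a b h h').2
  finite_preds a y := (Set.finite_le_nat y).subset (by
    rintro x ⟨rfl, -⟩
    exact Nat.le_succ x)
  finite_succs a x := (Set.finite_singleton (x + 1)).subset (by
    rintro y ⟨rfl, -⟩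
    rfl)

/-- The ideal acts as zero on the module of `pathDiagram`, whereas the prefix of length `n` carries
the basis vector at `0` to a vector with entry `1` at position `n`. -/
theorem pathProduct_notMem (hI : IsGentle I) (i : V) (q : List (Quiver.Total V))
    (h_start : ∀ a, q[0]? = some a → a.left = i)
    (h_next : ∀ n a b, q[n]? = some a → q[n + 1]? = some b →
      b.left = a.right ∧ arrow k b * arrow k a ∉ I) :
    pathProduct k i q ∉ I := by
  let D := pathDiagram I i q h_start h_next
  have hD : D.IsPartialInjective :=
    ⟨fun a x x' y h h' => Nat.succ_injective (h.1.symm.trans h'.1), fun a x y y' h h' =>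
      h.1.trans h'.1.symm⟩
  let pos : ℕ → D.P := fun n => n
  let v : D.P → k := fun x : ℕ => if x = 0 then 1 else 0
  have key (n : ℕ) (hn : n ≤ q.length) :
      D.pathRep (pathProduct k i (q.take n)) v (pos n) = 1 := by
    induction n with
    | zero =>
      change D.pathRep (idem k i) v (pos 0) = 1
      rw [D.pathRep_idem, D.idemOp_apply]
      have hv : D.vertex (pos 0) = i := by simp [D, pos, pathDiagram]
      rw [if_pos hv]
      exact if_pos rfl
    | succ n ih =>
      have hstep : D.step q[n] (pos n) (pos (n + 1)) := ⟨rfl, List.getElem?_eq_getElem hn⟩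
      rw [List.take_succ_eq_append_getElem hn, pathProduct_concat, map_mul, Module.End.mul_apply,
        D.pathRep_arrow, hD.arrowOp_apply_of_step hstep, ih (Nat.le_of_succ_le hn)]
  intro hmem
  have := key q.length le_rfl
  rw [List.take_length, D.pathRep_eq_zero hI _ hmem] at this
  exact zero_ne_one this

variable (I) in
/-- The sequence `x` is the sequence of letters of a string starting at the vertex `i`. -/
structure IsStringSequence (i : V) (x : ℕ → Option (Letter V)) : Prop where
  start : ∀ l, x 0 = some l → l.source = i
  next : ∀ j l l', x j = some l → x (j + 1) = some l' → l.target = l'.source ∧ l.Compatible I l'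

/-- An endless run of direct letters would give arbitrarily long paths outside `I`, against
nilpotency. This ensures that the initial path exists. -/
theorem IsStringSequence.exists_ne_direct (hI : IsGentle I) {i : V} {x : ℕ → Option (Letter V)}
    (hx : IsStringSequence I i x) : ∃ j, ∀ a, x j ≠ some (.direct a) := by
  by_contra! h
  choose f hf using h
  obtain ⟨N, hN⟩ := hI.nilpotent
  refine pathProduct_notMem hI i ((List.range N).map f) ?_ ?_ ?_
  · intro a ha
    obtain ⟨n, hn, rfl⟩ := List.getElem_of_getElem? ha
    simpa using! hx.start _ (hf 0)
  · intro n a b ha hb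
    obtain ⟨hn, rfl⟩ := List.getElem?_eq_some_iff.mp ha
    obtain ⟨hn', rfl⟩ := List.getElem?_eq_some_iff.mp hb
    have := hx.next n _ _ (hf n) (hf (n + 1))
    simpa using! And.intro this.1.symm (this.2.2.1 _ _ rfl rfl)
  · obtain h | ⟨j, q, hq, h⟩ := pathProduct_eq_ofPath (k := k) i ((List.range N).map f)
    · rw [h]; exact I.zero_mem
    · rw [h]; exact hN i j q (by simp [hq])

theorem IsStringSequence.exists_isInitialPath (hI : IsGentle I) {i : V} {x : ℕ → Option (Letter V)}
    (hx : IsStringSequence I i x) : ∃ p, IsInitialPath x p := by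
  classical
  have h := hx.exists_ne_direct hI
  have hlt (j : Fin (Nat.find h)) : ∃ a, x j = some (.direct a) := by
    simpa using Nat.find_min h j.2
  choose f hf using hlt
  refine ⟨List.ofFn f, fun j hj => ?_, ?_⟩
  · rw [List.getElem_ofFn]
    exact hf ⟨j, by simpa using hj⟩
  · rw [List.length_ofFn]
    exact Nat.find_spec h

/-- Consecutive arrows of the initial path already compose outside `I`, so `p l ∈ I` can only come
from the junction of `l` with the first arrow of `p`. The initial path thus disappears from the
condition, leaving only the first letter. -/
theorem IsStringSequence.endCondition_iff (hI : IsGentle I) {i : V} {x : ℕ → Option (Letter V)}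
    (hx : IsStringSequence I i x) :
    EndCondition I i x ↔ ∀ a c : Quiver.Total V, a.right = c.left → arrow k c * arrow k a ∈ I →
      i = c.right →
        (∃ d, x 0 = some (.direct d) ∧ arrow k d * arrow k c ∈ I) ∨ x 0 = some (.inverse c) := by
  constructor
  · rintro h a c hac hca rfl
    by_contra! hcon
    obtain ⟨p, hp⟩ := hx.exists_isInitialPath hI
    refine h p hp c ?_ hcon.2 ⟨a, hac, hca⟩
    rw [pathProduct_mul_arrow]
    refine pathProduct_notMem hI _ _ (by simp) fun n a b ha hb => ?_
    obtain ⟨hn, rfl⟩ := List.getElem?_eq_some_iff.mp (List.getElem?_cons_succ.symm.trans hb)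
    -- For the list `c :: p`, index `0` is the junction of `c` with the first letter; later indices
    -- are consecutive letters of the string.
    rcases n with _ | n
    · obtain rfl : c = a := by simpa using ha
      exact ⟨hx.start _ (hp.1 0 hn), hcon.1 _ (hp.1 0 hn)⟩
    · obtain ⟨hn', rfl⟩ := List.getElem?_eq_some_iff.mp (List.getElem?_cons_succ.symm.trans ha)
      have := hx.next n _ _ (hp.1 n hn') (hp.1 (n + 1) hn)
      exact ⟨this.1.symm, this.2.2.1 _ _ rfl rfl⟩
  · rintro h p hp l hpl hxl ⟨a, hal, hla⟩
    rw [pathProduct, foldl_arrow_mul] at hpl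
    have hli : i = l.right := by
      by_contra hne
      rw [idem_mul_arrow_of_ne l (Ne.symm hne)] at hpl
      exact hpl (foldl_arrow_mem p I.zero_mem)
    obtain ⟨d, hd, hdl⟩ := (h a l hal hla hli).resolve_right hxl
    -- The first letter is the direct letter `d`, so `p` begins with `d`, and `dl ∈ I` puts the
    -- whole product in `I`.
    cases p with
    | nil => exact hp.2 d hd
    | cons d' p =>
      obtain rfl : d' = d := by
        have := (hp.1 0 (by simp)).symm.trans hd
        simpa using this
      subst hli
      rw [idem_mul_arrow, List.foldl_cons] at hpl
      exact hpl (foldl_arrow_mem p hdl)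

/-- At an end of a string the only letter leaving is the first one read from that end, so exactness
there is the local form of the end condition. -/
theorem StringDiagram.exactAt_iff_endCondition (hI : IsGentle I) (D : StringDiagram I) (v : D.P)
    {x : ℕ → Option (Letter V)} (hx : IsStringSequence I (D.vertex v) x)
    (h : ∀ l, D.Leaves v l ↔ x 0 = some l) : D.ExactAt v ↔ EndCondition I (D.vertex v) x := by
  rw [hx.endCondition_iff hI]
  refine forall₂_congr fun a c => forall₃_congr fun _ _ _ => or_congr (exists_congr fun d => ?_) ?_
  · rw [← h, exists_and_right]; rfl
  · rw [← h]; rfl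

theorem Letter.source_inv {W : Type u} [Quiver.{u} W] (l : Letter W) : l.inv.source = l.target := by
  cases l <;> rfl

theorem Letter.target_inv {W : Type u} [Quiver.{u} W] (l : Letter W) : l.inv.target = l.source := by
  cases l <;> rfl

theorem Letter.inv_inv {W : Type u} [Quiver.{u} W] (l : Letter W) : l.inv.inv = l := by
  cases l <;> rfl

theorem Letter.Compatible.inv {l l' : Letter V} (h : l.Compatible I l') :
    l'.inv.Compatible I l.inv := by
  refine ⟨fun h' => h.1 ?_, fun a b ha hb => ?_, fun a b ha hb => ?_⟩
  · rw [Letter.inv_inv] at h'; exact h'.symm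
  · exact h.2.2 a b (by rw [← l.inv_inv, hb]; rfl) (by rw [← l'.inv_inv, ha]; rfl)
  · exact h.2.1 a b (by rw [← l.inv_inv, hb]; rfl) (by rw [← l'.inv_inv, ha]; rfl)

end EndConditions

/-! ### Interior positions and ends of finite strings and ℕ-strings -/

section Strings

variable {k V : Type u} [Field k] [Quiver.{u} V] [Fintype V]
  {I : TwoSidedIdeal (PathAlgebra k V)}

namespace NString

variable (w : NString I)

/-- Two different steps of one arrow into, or out of, the same position would come from adjacent
mutually inverse letters, which a string excludes. -/
theorem isPartialInjective_diagram : w.diagram.IsPartialInjective where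
  pred_unique := by
    rintro a x x' y ⟨j, ⟨rfl, rfl, h⟩ | ⟨rfl, rfl, h⟩⟩ ⟨j', ⟨rfl, h₁, h'⟩ | ⟨rfl, h₁, h'⟩⟩
    · exact Nat.succ_injective h₁
    · subst h₁
      exact absurd (by rw [h, h']; rfl) (w.compatible x).1
    · subst h₁
      exact absurd (by rw [h, h']; rfl) (w.compatible x').1
    · exact congrArg Nat.succ h₁
  succ_unique := by
    rintro a x y y' ⟨j, ⟨rfl, rfl, h⟩ | ⟨rfl, rfl, h⟩⟩ ⟨j', ⟨h₁, rfl, h'⟩ | ⟨h₁, rfl, h'⟩⟩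
    · exact congrArg Nat.succ h₁
    · subst h₁
      exact absurd (by rw [h, h']; rfl) (w.compatible y').1
    · subst h₁
      exact absurd (by rw [h, h']; rfl) (w.compatible y).1
    · exact Nat.succ_injective h₁

theorem leaves_letter (j : ℕ) : w.diagram.Leaves j (w.letter j) := by
  cases h : w.letter j with
  | direct a => exact ⟨j + 1, j, Or.inl ⟨rfl, rfl, h⟩⟩
  | inverse a => exact ⟨j + 1, j, Or.inr ⟨rfl, rfl, h⟩⟩

theorem leaves_letter_inv (j : ℕ) : w.diagram.Leaves (j + 1 : ℕ) (w.letter j).inv := by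
  cases h : w.letter j with
  | direct a => exact ⟨j, j, Or.inl ⟨rfl, rfl, h⟩⟩
  | inverse a => exact ⟨j, j, Or.inr ⟨rfl, rfl, h⟩⟩

theorem leaves_zero_iff (l : Letter V) : w.diagram.Leaves (0 : ℕ) l ↔ w.fromStart 0 = some l := by
  refine ⟨fun h => congrArg some ?_, fun h => Option.some_injective _ h ▸ w.leaves_letter 0⟩
  cases l with
  | direct a =>
    obtain ⟨y, j, ⟨hj, -, h⟩ | ⟨hj, -, h⟩⟩ := h
    · obtain rfl : 0 = j := hj
      exact h
    · exact absurd hj (Nat.succ_ne_zero j).symm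
  | inverse a =>
    obtain ⟨y, j, ⟨-, hj, h⟩ | ⟨-, hj, h⟩⟩ := h
    · exact absurd hj (Nat.succ_ne_zero j).symm
    · obtain rfl : 0 = j := hj
      exact h

theorem isStringSequence_fromStart : IsStringSequence I (w.vertex 0) w.fromStart where
  start l h := by
    obtain rfl := Option.some_injective _ h
    exact w.source_letter 0
  next j l l' h h' := by
    obtain rfl := Option.some_injective _ h
    obtain rfl := Option.some_injective _ h'
    exact ⟨(w.target_letter j).trans (w.source_letter (j + 1)).symm, w.compatible j⟩

theorem forall_exactAt_iff (hI : IsGentle I) :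
    (∀ x, w.diagram.ExactAt x) ↔ EndCondition I (w.vertex 0) w.fromStart := by
  have h0 : w.diagram.ExactAt (0 : ℕ) ↔ EndCondition I (w.vertex 0) w.fromStart :=
    w.diagram.exactAt_iff_endCondition hI (0 : ℕ) w.isStringSequence_fromStart w.leaves_zero_iff
  rw [← h0]
  refine ⟨fun h => h _, fun h x => ?_⟩
  obtain _ | j := (x : ℕ)
  · exact h
  · exact StringDiagram.exactAt_of_leaves hI (w.leaves_letter_inv j) (w.leaves_letter (j + 1))
      (by rw [Letter.inv_inv]; exact w.compatible j)

end NString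

namespace FiniteString

variable {n : ℕ} (w : FiniteString I n)

theorem isPartialInjective_diagram : w.diagram.IsPartialInjective where
  pred_unique := by
    rintro a x x' y ⟨j, ⟨rfl, rfl, h⟩ | ⟨rfl, rfl, h⟩⟩ ⟨j', ⟨rfl, h₁, h'⟩ | ⟨rfl, h₁, h'⟩⟩
    · rw [Fin.succ_injective _ h₁]
    · exact absurd (by rw [h, h']; rfl) (w.compatible j j' (by simpa [Fin.ext_iff] using h₁)).1
    · exact absurd (by rw [h, h']; rfl)
        (w.compatible j' j (by simpa [Fin.ext_iff] using h₁.symm)).1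
    · rw [Fin.castSucc_injective _ h₁]
  succ_unique := by
    rintro a x y y' ⟨j, ⟨rfl, rfl, h⟩ | ⟨rfl, rfl, h⟩⟩ ⟨j', ⟨h₁, rfl, h'⟩ | ⟨h₁, rfl, h'⟩⟩
    · rw [Fin.castSucc_injective _ h₁]
    · exact absurd (by rw [h, h']; rfl)
        (w.compatible j' j (by simpa [Fin.ext_iff] using h₁.symm)).1
    · exact absurd (by rw [h, h']; rfl) (w.compatible j j' (by simpa [Fin.ext_iff] using h₁)).1
    · rw [Fin.succ_injective _ h₁]

theorem leaves_iff (x : Fin (n + 1)) (l : Letter V) : w.diagram.Leaves x l ↔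
    ∃ j : Fin n, (x = j.castSucc ∧ w.letter j = l) ∨ (x = j.succ ∧ (w.letter j).inv = l) := by
  constructor
  · intro h
    cases l with
    | direct a =>
      obtain ⟨y, j, ⟨rfl, -, h⟩ | ⟨rfl, -, h⟩⟩ := h
      · exact ⟨j, Or.inl ⟨rfl, h⟩⟩
      · exact ⟨j, Or.inr ⟨rfl, by rw [h]; rfl⟩⟩
    | inverse a =>
      obtain ⟨y, j, ⟨-, rfl, h⟩ | ⟨-, rfl, h⟩⟩ := h
      · exact ⟨j, Or.inr ⟨rfl, by rw [h]; rfl⟩⟩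
      · exact ⟨j, Or.inl ⟨rfl, h⟩⟩
  · rintro ⟨j, ⟨rfl, rfl⟩ | ⟨rfl, rfl⟩⟩
    · cases h : w.letter j with
      | direct a => exact ⟨j.succ, j, Or.inl ⟨rfl, rfl, h⟩⟩
      | inverse a => exact ⟨j.succ, j, Or.inr ⟨rfl, rfl, h⟩⟩
    · cases h : w.letter j with
      | direct a => exact ⟨j.castSucc, j, Or.inl ⟨rfl, rfl, h⟩⟩
      | inverse a => exact ⟨j.castSucc, j, Or.inr ⟨rfl, rfl, h⟩⟩

theorem fromStart_eq_some_iff (j : ℕ) (l : Letter V) :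
    w.fromStart j = some l ↔ ∃ h : j < n, w.letter ⟨j, h⟩ = l := by
  by_cases h : j < n <;> simp [fromStart, h]

theorem fromEnd_eq_some_iff (j : ℕ) (l : Letter V) :
    w.fromEnd j = some l ↔ ∃ h : j < n, (w.letter (Fin.rev ⟨j, h⟩)).inv = l := by
  by_cases h : j < n <;> simp [fromEnd, h]

theorem leaves_zero_iff (l : Letter V) :
    w.diagram.Leaves (0 : Fin (n + 1)) l ↔ w.fromStart 0 = some l := by
  rw [leaves_iff, fromStart_eq_some_iff]
  constructor
  · rintro ⟨⟨j, hj⟩, ⟨h, rfl⟩ | ⟨h, -⟩⟩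
    · obtain rfl : 0 = j := by simpa [Fin.ext_iff] using h
      exact ⟨hj, rfl⟩
    · simp [Fin.ext_iff] at h
  · rintro ⟨h, rfl⟩
    exact ⟨⟨0, h⟩, Or.inl ⟨rfl, rfl⟩⟩

theorem leaves_last_iff (l : Letter V) :
    w.diagram.Leaves (Fin.last n) l ↔ w.fromEnd 0 = some l := by
  rw [leaves_iff, fromEnd_eq_some_iff]
  constructor
  · rintro ⟨⟨j, hj⟩, ⟨h, -⟩ | ⟨h, rfl⟩⟩
    · simp only [Fin.ext_iff, Fin.val_last, Fin.val_castSucc] at h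
      omega
    · simp only [Fin.ext_iff, Fin.val_last, Fin.val_succ] at h
      refine ⟨by omega, ?_⟩
      congr 2
      ext
      simp only [Fin.val_rev]
      omega
  · rintro ⟨h, rfl⟩
    refine ⟨_, Or.inr ⟨?_, rfl⟩⟩
    ext
    simp only [Fin.val_last, Fin.val_succ, Fin.val_rev]
    omega

theorem isStringSequence_fromStart : IsStringSequence I (w.vertex 0) w.fromStart where
  start l h := by
    obtain ⟨h, rfl⟩ := (w.fromStart_eq_some_iff _ _).mp h
    exact w.source_letter _
  next j l l' h h' := by
    obtain ⟨hj, rfl⟩ := (w.fromStart_eq_some_iff _ _).mp h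
    obtain ⟨hj', rfl⟩ := (w.fromStart_eq_some_iff _ _).mp h'
    exact ⟨(w.target_letter ⟨j, hj⟩).trans (w.source_letter ⟨j + 1, hj'⟩).symm, w.compatible _ _ rfl⟩

theorem isStringSequence_fromEnd : IsStringSequence I (w.vertex (Fin.last n)) w.fromEnd where
  start l h := by
    obtain ⟨h, rfl⟩ := (w.fromEnd_eq_some_iff _ _).mp h
    rw [Letter.source_inv, w.target_letter]
    congr 1
    ext
    simp only [Fin.val_last, Fin.val_succ, Fin.val_rev]
    omega
  next j l l' h h' := by
    obtain ⟨h, rfl⟩ := (w.fromEnd_eq_some_iff _ _).mp h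
    obtain ⟨h', rfl⟩ := (w.fromEnd_eq_some_iff _ _).mp h'
    refine ⟨?_, (w.compatible _ _ ?_).inv⟩
    · rw [Letter.source_inv, Letter.target_inv, w.target_letter, w.source_letter]
      congr 1
      ext
      simp only [Fin.val_castSucc, Fin.val_succ, Fin.val_rev]
      omega
    · simp only [Fin.val_rev]
      omega

/-- Only the two ends impose conditions. For a trivial string they are the same position, and both
end conditions express exactness there. -/
theorem forall_exactAt_iff (hI : IsGentle I) :
    (∀ x, w.diagram.ExactAt x) ↔ EndCondition I (w.vertex 0) w.fromStart ∧
      EndCondition I (w.vertex (Fin.last n)) w.fromEnd := by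
  have h0 : w.diagram.ExactAt (0 : Fin (n + 1)) ↔ EndCondition I (w.vertex 0) w.fromStart :=
    w.diagram.exactAt_iff_endCondition hI (0 : Fin (n + 1)) w.isStringSequence_fromStart
      w.leaves_zero_iff
  have hn : w.diagram.ExactAt (Fin.last n) ↔ EndCondition I (w.vertex (Fin.last n)) w.fromEnd :=
    w.diagram.exactAt_iff_endCondition hI (Fin.last n) w.isStringSequence_fromEnd
      w.leaves_last_iff
  rw [← h0, ← hn]
  refine ⟨fun h => ⟨h _, h _⟩, fun ⟨h0, hn⟩ (x : Fin (n + 1)) => ?_⟩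
  by_cases hx0 : x = 0
  · exact hx0 ▸ h0
  by_cases hxn : x = Fin.last n
  · exact hxn ▸ hn
  obtain ⟨j, rfl⟩ := Fin.exists_succ_eq.mpr hx0
  obtain ⟨j', hj'⟩ := Fin.exists_castSucc_eq.mpr hxn
  refine StringDiagram.exactAt_of_leaves hI ((w.leaves_iff _ _).mpr ⟨j, Or.inr ⟨rfl, rfl⟩⟩)
    ((w.leaves_iff _ _).mpr ⟨j', Or.inl ⟨hj'.symm, rfl⟩⟩) ?_
  rw [Letter.inv_inv]
  exact w.compatible j j' (by simpa [Fin.ext_iff] using hj'.symm)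

end FiniteString

end Strings

end

theorem mainTheorem7 {k V : Type u} [Field k] [Quiver.{u} V] [Fintype V]
    (I : TwoSidedIdeal (PathAlgebra k V)) (hI : IsGentle I) :
    (∀ (n : ℕ) (w : FiniteString I n),
      CategoryTheory.HasInjectiveDimensionLE (w.stringModule hI) 1 ↔
        EndCondition I (w.vertex 0) w.fromStart ∧
          EndCondition I (w.vertex (Fin.last n)) w.fromEnd) ∧
    (∀ w : NString I,
      (CategoryTheory.HasInjectiveDimensionLE (w.stringModule hI) 1 ↔
        EndCondition I (w.vertex 0) w.fromStart) ∧
      (CategoryTheory.HasInjectiveDimensionLE (w.prodStringModule hI) 1 ↔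
        EndCondition I (w.vertex 0) w.fromStart) ∧
      (CategoryTheory.HasInjectiveDimensionLE (w.sumStringModule hI) 1 ↔
        EndCondition I (w.vertex 0) w.fromStart)) := by
  refine ⟨fun n w => ?_, fun w => ?_⟩
  · rw [hasInjectiveDimensionLE_one_iff_arrowExact hI, ← w.forall_exactAt_iff hI]
    exact w.diagram.arrowExact_prodModule_iff hI w.isPartialInjective_diagram
  · have hprod : CategoryTheory.HasInjectiveDimensionLE (w.prodStringModule hI) 1 ↔
        EndCondition I (w.vertex 0) w.fromStart := by
      rw [hasInjectiveDimensionLE_one_iff_arrowExact hI, ← w.forall_exactAt_iff hI]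
      exact w.diagram.arrowExact_prodModule_iff hI w.isPartialInjective_diagram
    have hsum : CategoryTheory.HasInjectiveDimensionLE (w.sumStringModule hI) 1 ↔
        EndCondition I (w.vertex 0) w.fromStart := by
      rw [hasInjectiveDimensionLE_one_iff_arrowExact hI, ← w.forall_exactAt_iff hI]
      exact w.diagram.arrowExact_sumModule_iff hI w.isPartialInjective_diagram
    refine ⟨?_, hprod, hsum⟩
    rw [NString.stringModule]
    -- The criterion is the same for the product and the sum, so it does not matter whether `w` is
    -- expanding.
    split_ifs
    · exact hprod
    · exact hsum
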